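/- **Setting.** Let $L:\mathbb R^n\times\mathbb R^m\to\mathbb R$ be twice differentiable, write $z=(x,y)$, and let $\rho\in\mathbb R$, $\eta>0$, $\eta>\rho$, $\alpha>0$. Assume - $L$ is $\rho$-weakly convex–weakly concave: $\nabla^2_{xx}L(z)\succeq-\rho I$ and $-\nabla^2_{yy}L(z)\succeq-\rho I$ for all $z$; - $L$ is $\alpha$-interaction dominant in $y$: $-\nabla^2_{yy}L(z)+\nabla^2_{yx}L(z)\,(\eta I+\nabla^2_{xx}L(z))^{-1}\,\nabla^2_{xy}L(z)\succeq\alpha I$ for all $z$. Let $\mathrm{prox}_\eta(x,y)=\arg\min_{u}\max_{v}\ L(u,v)+\frac\eta2\|u-x\|^2-\frac\eta2\|v-y\|^2$, let $L_\eta(x,y)$ be the value of this minimax problem (the saddle envelope), and let $\Phi(x)=\sup_y L_\eta(x,y)$. For $\lambda,\gamma\in[0,1]$ and an initial point $(x_0,y_0)$, the damped proximal point method is $$x_{k+1}=\lambda x_k^++(1-\lambda)x_k,\qquad y_{k+1}=\gamma y_k^++(1-\gamma)y_k,\qquad (x_k^+,y_k^+)=\mathrm{prox}_\eta(x_k,y_k).$$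 **Theorem.** Under these assumptions $\mathrm{prox}_\eta$ is well defined, i.e. its minimax problem has exactly one solution for every $(x,y)$. Moreover, there is an absolute constant $c\in(0,1]$ such that the following holds for all $0<b\le1$ and $0<a\le cb$. Run the method with $$\lambda=a\,\frac{\min\{1,|\eta/\rho-1|^3\}}{(1+\eta/\alpha)^2},\qquad \gamma=b\,\min\{1,|\eta/\rho-1|\}$$ (for $\rho=0$ both minima are read as $1$). Suppose that $\Phi$ is bounded below, with $\Phi(x_0)-\inf\Phi\le\Delta<\infty$, and that the sequence $y_k$ is bounded, with $\|y_k\|\le R$ for all $k$. Then for every $\varepsilon>0$ there is an iteration $T\le C\varepsilon^{-2}$ with $$\|\nabla L(x_T^+,y_T^+)\|\le\varepsilon,$$ where $C$ depends only on $a,b,\rho,\eta,\alpha,\Delta,R$ (not on $\varepsilon$, $n$, $m$, $L$ or the initial point). -/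

import Mathlib

noncomputable section

/-- `ℝⁿ` with the Euclidean norm and inner product. -/
abbrev Eu (n : ℕ) : Type := EuclideanSpace ℝ (Fin n)

/-- The partial gradient `∇ₓ L(z)`. -/
def gradX {n m : ℕ} (L : Eu n × Eu m → ℝ) (z : Eu n × Eu m) : Eu n :=
  gradient (fun u : Eu n => L (u, z.2)) z.1

/-- The partial gradient `∇_y L(z)`. -/
def gradY {n m : ℕ} (L : Eu n × Eu m → ℝ) (z : Eu n × Eu m) : Eu m :=
  gradient (fun v : Eu m => L (z.1, v)) z.2

/-- The Euclidean norm of the full gradient, `‖∇L(z)‖`. -/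
def gradNorm {n m : ℕ} (L : Eu n × Eu m → ℝ) (z : Eu n × Eu m) : ℝ :=
  Real.sqrt (‖gradX L z‖ ^ 2 + ‖gradY L z‖ ^ 2)

/-- The Hessian block `∇²ₓₓ L(z)`, an `n × n` matrix seen as an operator. -/
def hessXX {n m : ℕ} (L : Eu n × Eu m → ℝ) (z : Eu n × Eu m) : Eu n →L[ℝ] Eu n :=
  fderiv ℝ (fun u : Eu n => gradX L (u, z.2)) z.1

/-- The Hessian block `∇²ₓᵧ L(z)`, an `n × m` matrix: the derivative in `y` of `∇ₓ L`. -/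
def hessXY {n m : ℕ} (L : Eu n × Eu m → ℝ) (z : Eu n × Eu m) : Eu m →L[ℝ] Eu n :=
  fderiv ℝ (fun v : Eu m => gradX L (z.1, v)) z.2

/-- The Hessian block `∇²ᵧₓ L(z)`, an `m × n` matrix: the derivative in `x` of `∇_y L`. -/
def hessYX {n m : ℕ} (L : Eu n × Eu m → ℝ) (z : Eu n × Eu m) : Eu n →L[ℝ] Eu m :=
  fderiv ℝ (fun u : Eu n => gradY L (u, z.2)) z.1

/-- The Hessian block `∇²ᵧᵧ L(z)`, an `m × m` matrix. -/
def hessYY {n m : ℕ} (L : Eu n × Eu m → ℝ) (z : Eu n × Eu m) : Eu m →L[ℝ] Eu m :=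
  fderiv ℝ (fun v : Eu m => gradY L (z.1, v)) z.2

/-- `A ⪰ t I`, through the quadratic form; it is used below only for operators that are symmetric
because `L` is twice differentiable. -/
def LoewnerGe {k : ℕ} (A : Eu k →L[ℝ] Eu k) (t : ℝ) : Prop :=
  ∀ w : Eu k, t * ‖w‖ ^ 2 ≤ inner ℝ (A w) w

/-- `L` is twice (Fréchet) differentiable everywhere on `ℝⁿ × ℝᵐ`. -/
def TwiceDifferentiable {n m : ℕ} (L : Eu n × Eu m → ℝ) : Prop :=
  Differentiable ℝ L ∧ Differentiable ℝ (fderiv ℝ L)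

/-- `L` is `ρ`-weakly convex-weakly concave: it is twice differentiable and, at every point,
`∇²ₓₓ L ⪰ -ρ I` and `-∇²ᵧᵧ L ⪰ -ρ I`. -/
structure IsWeaklyConvexWeaklyConcave {n m : ℕ} (ρ : ℝ) (L : Eu n × Eu m → ℝ) : Prop where
  twiceDifferentiable : TwiceDifferentiable L
  weaklyConvex : ∀ z, LoewnerGe (hessXX L z) (-ρ)
  weaklyConcave : ∀ z, LoewnerGe (-hessYY L z) (-ρ)

/-- `L` is `α`-interaction dominant in `y` (for the proximal parameter `η`): at every point,
`-∇²ᵧᵧ L + ∇²ᵧₓ L (η I + ∇²ₓₓ L)⁻¹ ∇²ₓᵧ L ⪰ α I`.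
The inverse is that of the ring of operators; `η I + ∇²ₓₓ L` is positive definite, hence invertible,
when `L` is `ρ`-weakly convex in `x` with `ρ < η`. -/
def IsInteractionDominantInY {n m : ℕ} (η α : ℝ) (L : Eu n × Eu m → ℝ) : Prop :=
  ∀ z, LoewnerGe
    (-hessYY L z +
      (hessYX L z).comp
        ((Ring.inverse (η • (1 : Eu n →L[ℝ] Eu n) + hessXX L z)).comp (hessXY L z))) α

/-- The objective `(u, v) ↦ L(u,v) + (η/2)‖u - x‖² - (η/2)‖v - y‖²` of the proximal subproblem
at `z = (x, y)`. -/
def proxObjective {n m : ℕ} (L : Eu n × Eu m → ℝ) (η : ℝ) (z w : Eu n × Eu m) : ℝ :=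
  L w + η / 2 * ‖w.1 - z.1‖ ^ 2 - η / 2 * ‖w.2 - z.2‖ ^ 2

/-- `w = (u, v)` solves `min_u max_v M(u,v)`: `u` minimizes `u ↦ sup_v M(u,v)` and `v` maximizes
`M(u,·)`. The suprema are taken in the extended reals. -/
def IsMinimaxPoint {n m : ℕ} (M : Eu n × Eu m → ℝ) (w : Eu n × Eu m) : Prop :=
  (∀ u : Eu n, (⨆ v : Eu m, (M (w.1, v) : EReal)) ≤ ⨆ v : Eu m, (M (u, v) : EReal)) ∧
    ∀ v : Eu m, M (w.1, v) ≤ M w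

/-- The proximal operator
`prox_η(x,y) = argmin_u max_v L(u,v) + (η/2)‖u - x‖² - (η/2)‖v - y‖²`. -/
def prox {n m : ℕ} (L : Eu n × Eu m → ℝ) (η : ℝ) (z : Eu n × Eu m) : Eu n × Eu m :=
  Classical.epsilon (IsMinimaxPoint (proxObjective L η z))

/-- The saddle envelope
`L_η(x,y) = min_u max_v L(u,v) + (η/2)‖u - x‖² - (η/2)‖v - y‖²`, as an extended real. -/
def saddleEnvelope {n m : ℕ} (L : Eu n × Eu m → ℝ) (η : ℝ) (z : Eu n × Eu m) : EReal :=
  ⨅ u : Eu n, ⨆ v : Eu m, (proxObjective L η z (u, v) : EReal)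

/-- The function `Φ(x) = max_y L_η(x,y)` that the minimax problem for the saddle envelope minimizes,
as an extended real. -/
def envelopePrimal {n m : ℕ} (L : Eu n × Eu m → ℝ) (η : ℝ) (x : Eu n) : EReal :=
  ⨆ y : Eu m, saddleEnvelope L η (x, y)

/-- The two-parameter damped proximal point method: with `(xₖ⁺, yₖ⁺) = prox_η(xₖ, yₖ)`,
`xₖ₊₁ = lam xₖ⁺ + (1 - lam) xₖ` and `yₖ₊₁ = gam yₖ⁺ + (1 - gam) yₖ`. -/
def dampedPPM {n m : ℕ} (L : Eu n × Eu m → ℝ) (η lam gam : ℝ) (z₀ : Eu n × Eu m) :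
    ℕ → Eu n × Eu m
  | 0 => z₀
  | k + 1 =>
    (lam • (prox L η (dampedPPM L η lam gam z₀ k)).1 +
        (1 - lam) • (dampedPPM L η lam gam z₀ k).1,
      gam • (prox L η (dampedPPM L η lam gam z₀ k)).2 +
        (1 - gam) • (dampedPPM L η lam gam z₀ k).2)

end

open Filter Topology

/-! The prox subproblem is strongly convex-strongly concave with modulus η − ρ, so its solution is
the unique root w of a stationarity system F(w) = z. Weak convexity-concavity makes w ↦ F(w)
strongly monotone, so the prox is Lipschitz with any constant K ≥ η/(η − ρ) (`prox_lipschitz`). As a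
continuous right inverse of the differentiable map F it is itself differentiable. Eliminating the
primal component from the linearized system produces exactly the operator in the interaction
dominance condition, which bounds the derivative of y ↦ y⁺ by η/(η + α) < 1
(`norm_prox_snd_sub_le`). Hence y ↦ y⁺ has a fixed point Y(x). It maximizes L_η(x,·), so Φ(x) =
L_η(x, Y(x)), and Y is Lipschitz.

The method is then a two-time-scale scheme. The distance d = ‖y − Y(x)‖ contracts by 1 − θ with θ =
γ/(1 + η/α), up to a drift of order λ‖x − x⁺‖ (`norm_sub_fixed_step`); Φ drops by order λ‖x − x⁺‖²,
up to an error of order λd² (`saddleValue_descent`). If λ is small compared with θ, the Lyapunov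
function Φ(x) + ηλ(2K²/θ)d² absorbs both errors (`lyapunov_step`). Since ∇L(z⁺) = η(x − x⁺, y⁺ − y),
each step lowers it by a multiple of ‖∇L(z⁺)‖², and telescoping gives the rate. -/

theorem quadratic_lower_bound {E : Type*} [NormedAddCommGroup E] [InnerProductSpace ℝ E]
    [CompleteSpace E] {f : E → ℝ} {f' : E → E} {f'' : E → E →L[ℝ] E} {σ : ℝ}
    (hf : ∀ u, HasGradientAt f (f' u) u) (hf' : ∀ u, HasFDerivAt f' (f'' u) u)
    (hσ : ∀ u w, σ * ‖w‖ ^ 2 ≤ inner ℝ (f'' u w) w) (u u' : E) :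
    f u + inner ℝ (f' u) (u' - u) + σ / 2 * ‖u' - u‖ ^ 2 ≤ f u' := by
  obtain ⟨d, rfl⟩ : ∃ d, u' = u + d := ⟨u' - u, by abel⟩
  rw [add_sub_cancel_left]
  have hline : ∀ t : ℝ, HasDerivAt (fun t : ℝ => u + t • d) d t := fun t => by
    simpa using ((hasDerivAt_id t).smul_const d).const_add u
  have h1 : ∀ t : ℝ, HasDerivAt (fun t : ℝ => f (u + t • d)) (inner ℝ (f' (u + t • d)) d) t := by
    intro t
    have := (hf (u + t • d)).hasFDerivAt.comp_hasDerivAt t (hline t)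
    rwa [InnerProductSpace.toDual_apply_apply] at this
  have h2 : ∀ t : ℝ, HasDerivAt (fun t : ℝ => inner ℝ (f' (u + t • d)) d)
      (inner ℝ (f'' (u + t • d) d) d) t := by
    intro t
    simpa using ((hf' (u + t • d)).comp_hasDerivAt t (hline t)).inner ℝ (hasDerivAt_const t d)
  -- The Hessian is not assumed continuous, so monotonicity is used twice in place of Taylor's
  -- formula with an integral remainder.
  have h3 : Monotone (fun t : ℝ => inner ℝ (f' (u + t • d)) d - t * (σ * ‖d‖ ^ 2)) := by
    refine monotone_of_hasDerivAt_nonneg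
      (fun t => (h2 t).sub ((hasDerivAt_id t).mul_const (σ * ‖d‖ ^ 2))) fun t => ?_
    have := hσ (u + t • d) d
    simpa using this
  have h4 : ∀ t : ℝ, HasDerivAt
      (fun t : ℝ => f (u + t • d) - t * inner ℝ (f' u) d - t ^ 2 * (σ / 2 * ‖d‖ ^ 2))
      (inner ℝ (f' (u + t • d)) d - inner ℝ (f' u) d - t * (σ * ‖d‖ ^ 2)) t := by
    intro t
    have := ((h1 t).sub ((hasDerivAt_id t).mul_const (inner ℝ (f' u) d))).sub
      ((hasDerivAt_pow 2 t).mul_const (σ / 2 * ‖d‖ ^ 2))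
    refine this.congr_deriv ?_
    simp; ring
  have h5 : MonotoneOn
      (fun t : ℝ => f (u + t • d) - t * inner ℝ (f' u) d - t ^ 2 * (σ / 2 * ‖d‖ ^ 2))
      (Set.Icc 0 1) := by
    refine monotoneOn_of_deriv_nonneg (convex_Icc 0 1)
      (fun t _ => (h4 t).continuousAt.continuousWithinAt)
      (fun t _ => (h4 t).differentiableAt.differentiableWithinAt) fun t ht => ?_
    rw [interior_Icc] at ht
    have := h3 ht.1.le
    simp only [zero_smul, add_zero, zero_mul, sub_zero] at this
    rw [(h4 t).deriv]
    linarith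
  have := h5 (Set.left_mem_Icc.2 zero_le_one) (Set.right_mem_Icc.2 zero_le_one) zero_le_one
  simp at this
  linarith

/-! ### Partial gradients, Hessian blocks and their symmetry. -/

section Derivatives

variable {n m : ℕ} {L : Eu n × Eu m → ℝ}

theorem hasFDerivAt_left (hL : Differentiable ℝ L) (u : Eu n) (v : Eu m) :
    HasFDerivAt (fun u => L (u, v)) ((fderiv ℝ L (u, v)).comp (.inl ℝ _ _)) u :=
  (hL (u, v)).hasFDerivAt.comp u (hasFDerivAt_prodMk_left u v)

theorem hasFDerivAt_right (hL : Differentiable ℝ L) (u : Eu n) (v : Eu m) :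
    HasFDerivAt (fun v => L (u, v)) ((fderiv ℝ L (u, v)).comp (.inr ℝ _ _)) v :=
  (hL (u, v)).hasFDerivAt.comp v (hasFDerivAt_prodMk_right u v)

theorem hasGradientAt_gradX (hL : Differentiable ℝ L) (u : Eu n) (v : Eu m) :
    HasGradientAt (fun u => L (u, v)) (gradX L (u, v)) u :=
  (hasFDerivAt_left hL u v).differentiableAt.hasGradientAt

theorem hasGradientAt_gradY (hL : Differentiable ℝ L) (u : Eu n) (v : Eu m) :
    HasGradientAt (fun v => L (u, v)) (gradY L (u, v)) v :=
  (hasFDerivAt_right hL u v).differentiableAt.hasGradientAt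

theorem gradX_eq (hL : Differentiable ℝ L) :
    gradX L = fun z => (InnerProductSpace.toDual ℝ (Eu n)).symm
      ((fderiv ℝ L z).comp (.inl ℝ _ _)) := by
  funext z
  rw [gradX, gradient, (hasFDerivAt_left hL z.1 z.2).fderiv]

theorem gradY_eq (hL : Differentiable ℝ L) :
    gradY L = fun z => (InnerProductSpace.toDual ℝ (Eu m)).symm
      ((fderiv ℝ L z).comp (.inr ℝ _ _)) := by
  funext z
  rw [gradY, gradient, (hasFDerivAt_right hL z.1 z.2).fderiv]

theorem inner_gradX (hL : Differentiable ℝ L) (z : Eu n × Eu m) (p : Eu n) :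
    inner ℝ (gradX L z) p = fderiv ℝ L z (p, 0) := by
  simp [gradX_eq hL]

theorem inner_gradY (hL : Differentiable ℝ L) (z : Eu n × Eu m) (q : Eu m) :
    inner ℝ (gradY L z) q = fderiv ℝ L z (0, q) := by
  simp [gradY_eq hL]

theorem differentiable_gradX (hL : TwiceDifferentiable L) : Differentiable ℝ (gradX L) := by
  rw [gradX_eq hL.1]
  exact (InnerProductSpace.toDual ℝ (Eu n)).symm.toContinuousLinearEquiv.differentiable.comp
    (hL.2.clm_comp (differentiable_const _))

theorem differentiable_gradY (hL : TwiceDifferentiable L) : Differentiable ℝ (gradY L) := by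
  rw [gradY_eq hL.1]
  exact (InnerProductSpace.toDual ℝ (Eu m)).symm.toContinuousLinearEquiv.differentiable.comp
    (hL.2.clm_comp (differentiable_const _))

theorem hasFDerivAt_hessXX (hL : TwiceDifferentiable L) (u : Eu n) (v : Eu m) :
    HasFDerivAt (fun u => gradX L (u, v)) (hessXX L (u, v)) u :=
  DifferentiableAt.hasFDerivAt ((differentiable_gradX hL _).comp u
    (hasFDerivAt_prodMk_left u v).differentiableAt)

theorem hasFDerivAt_hessYY (hL : TwiceDifferentiable L) (u : Eu n) (v : Eu m) :
    HasFDerivAt (fun v => gradY L (u, v)) (hessYY L (u, v)) v :=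
  DifferentiableAt.hasFDerivAt ((differentiable_gradY hL _).comp v
    (hasFDerivAt_prodMk_right u v).differentiableAt)

theorem fderiv_gradX_apply (hL : TwiceDifferentiable L) (z : Eu n × Eu m) (p : Eu n) (q : Eu m) :
    fderiv ℝ (gradX L) z (p, q) = hessXX L z p + hessXY L z q := by
  have h : HasFDerivAt (gradX L) (fderiv ℝ (gradX L) z) (z.1, z.2) :=
    (differentiable_gradX hL z).hasFDerivAt
  have h1 : hessXX L z = (fderiv ℝ (gradX L) z).comp (.inl ℝ _ _) :=
    HasFDerivAt.fderiv (HasFDerivAt.comp (g := gradX L) z.1 h (hasFDerivAt_prodMk_left (𝕜 := ℝ) z.1 z.2))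
  have h2 : hessXY L z = (fderiv ℝ (gradX L) z).comp (.inr ℝ _ _) :=
    HasFDerivAt.fderiv (HasFDerivAt.comp (g := gradX L) z.2 h (hasFDerivAt_prodMk_right (𝕜 := ℝ) z.1 z.2))
  simp [h1, h2, ← map_add]

theorem fderiv_gradY_apply (hL : TwiceDifferentiable L) (z : Eu n × Eu m) (p : Eu n) (q : Eu m) :
    fderiv ℝ (gradY L) z (p, q) = hessYX L z p + hessYY L z q := by
  have h : HasFDerivAt (gradY L) (fderiv ℝ (gradY L) z) (z.1, z.2) :=
    (differentiable_gradY hL z).hasFDerivAt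
  have h1 : hessYX L z = (fderiv ℝ (gradY L) z).comp (.inl ℝ _ _) :=
    HasFDerivAt.fderiv (HasFDerivAt.comp (g := gradY L) z.1 h (hasFDerivAt_prodMk_left (𝕜 := ℝ) z.1 z.2))
  have h2 : hessYY L z = (fderiv ℝ (gradY L) z).comp (.inr ℝ _ _) :=
    HasFDerivAt.fderiv (HasFDerivAt.comp (g := gradY L) z.2 h (hasFDerivAt_prodMk_right (𝕜 := ℝ) z.1 z.2))
  simp [h1, h2, ← map_add]

theorem inner_fderiv_gradX (hL : TwiceDifferentiable L) (z w : Eu n × Eu m) (p : Eu n) :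
    inner ℝ (fderiv ℝ (gradX L) z w) p = fderiv ℝ (fderiv ℝ L) z w (p, 0) := by
  have h1 := (differentiable_gradX hL z).hasFDerivAt.inner ℝ (hasFDerivAt_const p z)
  have h2 := (hL.2 z).hasFDerivAt.clm_apply (hasFDerivAt_const ((p, 0) : Eu n × Eu m) z)
  simp only [inner_gradX hL.1] at h1
  simpa using DFunLike.congr_fun (h1.unique h2) w

theorem inner_fderiv_gradY (hL : TwiceDifferentiable L) (z w : Eu n × Eu m) (q : Eu m) :
    inner ℝ (fderiv ℝ (gradY L) z w) q = fderiv ℝ (fderiv ℝ L) z w (0, q) := by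
  have h1 := (differentiable_gradY hL z).hasFDerivAt.inner ℝ (hasFDerivAt_const q z)
  have h2 := (hL.2 z).hasFDerivAt.clm_apply (hasFDerivAt_const ((0, q) : Eu n × Eu m) z)
  simp only [inner_gradY hL.1] at h1
  simpa using DFunLike.congr_fun (h1.unique h2) w

/-- The mixed Hessian blocks are transposes of each other. -/
theorem inner_hessXY_eq_inner_hessYX (hL : TwiceDifferentiable L) (z : Eu n × Eu m)
    (p : Eu n) (q : Eu m) :
    inner ℝ (hessXY L z q) p = inner ℝ (hessYX L z p) q := by
  have h1 := inner_fderiv_gradX hL z (0, q) p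
  have h2 := inner_fderiv_gradY hL z (p, 0) q
  rw [fderiv_gradX_apply hL, map_zero, zero_add] at h1
  rw [fderiv_gradY_apply hL, map_zero, add_zero] at h2
  rw [h1, h2]
  exact second_derivative_symmetric (fun y => (hL.1 y).hasFDerivAt) (hL.2 z).hasFDerivAt _ _

end Derivatives

/-! ### First-order inequalities for L and for the prox objective. -/

section StrongConvexity

variable {n m : ℕ} {L : Eu n × Eu m → ℝ} {ρ η : ℝ}

theorem IsWeaklyConvexWeaklyConcave.le_left (hL : IsWeaklyConvexWeaklyConcave ρ L)
    (u u' : Eu n) (v : Eu m) :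
    L (u, v) + inner ℝ (gradX L (u, v)) (u' - u) + -ρ / 2 * ‖u' - u‖ ^ 2 ≤ L (u', v) :=
  quadratic_lower_bound (hasGradientAt_gradX hL.twiceDifferentiable.1 · v)
    (hasFDerivAt_hessXX hL.twiceDifferentiable · v) (fun u w => hL.weaklyConvex (u, v) w) u u'

theorem IsWeaklyConvexWeaklyConcave.le_right (hL : IsWeaklyConvexWeaklyConcave ρ L)
    (u : Eu n) (v v' : Eu m) :
    L (u, v') ≤ L (u, v) + inner ℝ (gradY L (u, v)) (v' - v) - -ρ / 2 * ‖v' - v‖ ^ 2 := by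
  have := quadratic_lower_bound (f := fun v => -L (u, v)) (f' := fun v => -gradY L (u, v))
    (f'' := fun v => -hessYY L (u, v)) (σ := -ρ)
    (fun v => by
      have := (hasGradientAt_gradY hL.twiceDifferentiable.1 u v).hasFDerivAt.neg
      rwa [← map_neg] at this)
    (fun v => (hasFDerivAt_hessYY hL.twiceDifferentiable u v).neg)
    (fun v w => hL.weaklyConcave (u, v) w) v v'
  simp only [inner_neg_left] at this
  linarith

/-- The prox objective is `(η - ρ)`-strongly convex in its first variable. -/
theorem IsWeaklyConvexWeaklyConcave.proxObjective_le_left (hL : IsWeaklyConvexWeaklyConcave ρ L)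
    (z : Eu n × Eu m) (u u' : Eu n) (v : Eu m) :
    proxObjective L η z (u, v) + inner ℝ (gradX L (u, v) + η • (u - z.1)) (u' - u) +
      (η - ρ) / 2 * ‖u' - u‖ ^ 2 ≤ proxObjective L η z (u', v) := by
  have h := hL.le_left u u' v
  have h2 : ‖u' - z.1‖ ^ 2 = ‖u - z.1‖ ^ 2 + 2 * inner ℝ (u - z.1) (u' - u) + ‖u' - u‖ ^ 2 := by
    rw [← norm_add_sq_real]; congr 2; abel
  simp only [proxObjective, inner_add_left, real_inner_smul_left, h2]
  linarith

/-- The prox objective is `(η - ρ)`-strongly concave in its second variable. -/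
theorem IsWeaklyConvexWeaklyConcave.proxObjective_le_right (hL : IsWeaklyConvexWeaklyConcave ρ L)
    (z : Eu n × Eu m) (u : Eu n) (v v' : Eu m) :
    proxObjective L η z (u, v') ≤ proxObjective L η z (u, v) +
      inner ℝ (gradY L (u, v) - η • (v - z.2)) (v' - v) - (η - ρ) / 2 * ‖v' - v‖ ^ 2 := by
  have h := hL.le_right u v v'
  have h2 : ‖v' - z.2‖ ^ 2 = ‖v - z.2‖ ^ 2 + 2 * inner ℝ (v - z.2) (v' - v) + ‖v' - v‖ ^ 2 := by
    rw [← norm_add_sq_real]; congr 2; abel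
  simp only [proxObjective, inner_sub_left, real_inner_smul_left, h2]
  linarith

end StrongConvexity

/-! ### Existence and uniqueness of the prox saddle point. -/

section ProxExistence

variable {n m : ℕ} {L : Eu n × Eu m → ℝ} {ρ η : ℝ}

/-- The stationarity system of the prox objective at `z`. -/
def IsProxStationary (L : Eu n × Eu m → ℝ) (η : ℝ) (z w : Eu n × Eu m) : Prop :=
  gradX L w + η • (w.1 - z.1) = 0 ∧ gradY L w - η • (w.2 - z.2) = 0

theorem hasGradientAt_proxObjective_left (hL : Differentiable ℝ L) (z : Eu n × Eu m)
    (u : Eu n) (v : Eu m) :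
    HasGradientAt (fun u => proxObjective L η z (u, v)) (gradX L (u, v) + η • (u - z.1)) u := by
  have h := (((hasGradientAt_gradX hL u v).hasFDerivAt.add
    ((((hasFDerivAt_id u).sub_const z.1).norm_sq).const_mul (η / 2))).sub_const
    (η / 2 * ‖v - z.2‖ ^ 2))
  rw [hasGradientAt_iff_hasFDerivAt]
  refine h.congr_fderiv ?_
  ext w
  simp
  ring

theorem hasGradientAt_proxObjective_right (hL : Differentiable ℝ L) (z : Eu n × Eu m)
    (u : Eu n) (v : Eu m) :
    HasGradientAt (fun v => proxObjective L η z (u, v)) (gradY L (u, v) - η • (v - z.2)) v := by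
  have h := (((hasGradientAt_gradY hL u v).hasFDerivAt.add_const (η / 2 * ‖u - z.1‖ ^ 2)).sub
    ((((hasFDerivAt_id v).sub_const z.2).norm_sq).const_mul (η / 2)))
  rw [hasGradientAt_iff_hasFDerivAt]
  refine h.congr_fderiv ?_
  ext w
  simp
  ring

theorem IsLocalMin.hasGradientAt_eq_zero {E : Type*} [NormedAddCommGroup E]
    [InnerProductSpace ℝ E] [CompleteSpace E] {f : E → ℝ} {g a : E} (h : IsLocalMin f a)
    (hf : HasGradientAt f g a) : g = 0 := by
  simpa using h.hasFDerivAt_eq_zero hf.hasFDerivAt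

theorem IsLocalMax.hasGradientAt_eq_zero {E : Type*} [NormedAddCommGroup E]
    [InnerProductSpace ℝ E] [CompleteSpace E] {f : E → ℝ} {g a : E} (h : IsLocalMax f a)
    (hf : HasGradientAt f g a) : g = 0 := by
  simpa using h.hasFDerivAt_eq_zero hf.hasFDerivAt

theorem IsProxStationary.add_le (hL : IsWeaklyConvexWeaklyConcave ρ L) {z w : Eu n × Eu m}
    (hw : IsProxStationary L η z w) (u : Eu n) :
    proxObjective L η z w + (η - ρ) / 2 * ‖u - w.1‖ ^ 2 ≤ proxObjective L η z (u, w.2) := by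
  have := hL.proxObjective_le_left (η := η) z w.1 u w.2
  rw [show ((w.1, w.2) : Eu n × Eu m) = w from rfl, hw.1, inner_zero_left] at this
  linarith

theorem IsProxStationary.add_le' (hL : IsWeaklyConvexWeaklyConcave ρ L) {z w : Eu n × Eu m}
    (hw : IsProxStationary L η z w) (v : Eu m) :
    proxObjective L η z (w.1, v) + (η - ρ) / 2 * ‖v - w.2‖ ^ 2 ≤ proxObjective L η z w := by
  have := hL.proxObjective_le_right (η := η) z w.1 w.2 v
  rw [show ((w.1, w.2) : Eu n × Eu m) = w from rfl, hw.2, inner_zero_left] at this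
  linarith

/-- Sion's theorem gives a saddle point on a product of closed balls around x and y. Strong
convexity-concavity confines it to the interior of both balls, where constrained optimality in each
variable is a vanishing gradient. -/
theorem exists_isProxStationary (hL : IsWeaklyConvexWeaklyConcave ρ L) (hρη : ρ < η)
    (z : Eu n × Eu m) : ∃ w, IsProxStationary L η z w := by
  obtain ⟨x, y⟩ := z
  have hd := hL.twiceDifferentiable.1
  set σ := η - ρ with hσ
  have hσ0 : 0 < σ := sub_pos.2 hρη
  set M := proxObjective L η (x, y) with hM
  have hleft : ∀ v, Continuous fun u => M (u, v) := fun v => continuous_iff_continuousAt.2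
    fun u => (hasGradientAt_proxObjective_left hd (x, y) u v).hasFDerivAt.continuousAt
  have hright : ∀ u, Continuous fun v => M (u, v) := fun u => continuous_iff_continuousAt.2
    fun v => (hasGradientAt_proxObjective_right hd (x, y) u v).hasFDerivAt.continuousAt
  have hconv : ∀ v, ConvexOn ℝ Set.univ fun u => M (u, v) := by
    intro v
    refine ⟨convex_univ, fun u₁ _ u₂ _ a b ha hb hab => ?_⟩
    set u := a • u₁ + b • u₂ with hu
    have h1 := hL.proxObjective_le_left (η := η) (x, y) u u₁ v
    have h2 := hL.proxObjective_le_left (η := η) (x, y) u u₂ v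
    have h3 : a • (u₁ - u) + b • (u₂ - u) = 0 := by
      rw [smul_sub, smul_sub, sub_add_sub_comm, ← add_smul, hab, one_smul, hu, sub_self]
    have h4 := congrArg (inner ℝ (gradX L (u, v) + η • (u - x))) h3
    rw [inner_add_right, real_inner_smul_right, real_inner_smul_right, inner_zero_right] at h4
    have p1 : 0 ≤ σ / 2 * ‖u₁ - u‖ ^ 2 := by positivity
    have p2 : 0 ≤ σ / 2 * ‖u₂ - u‖ ^ 2 := by positivity
    have h1' := mul_le_mul_of_nonneg_left
      (show M (u, v) + inner ℝ (gradX L (u, v) + η • (u - x)) (u₁ - u) ≤ M (u₁, v) by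
        linarith) ha
    have h2' := mul_le_mul_of_nonneg_left
      (show M (u, v) + inner ℝ (gradX L (u, v) + η • (u - x)) (u₂ - u) ≤ M (u₂, v) by
        linarith) hb
    have h5 : a * M (u, v) + b * M (u, v) = M (u, v) := by rw [← add_mul, hab, one_mul]
    simp only [smul_eq_mul]
    linarith
  have hconc : ∀ u, ConcaveOn ℝ Set.univ fun v => M (u, v) := by
    intro u
    refine ⟨convex_univ, fun v₁ _ v₂ _ a b ha hb hab => ?_⟩
    set v := a • v₁ + b • v₂ with hv
    have h1 := hL.proxObjective_le_right (η := η) (x, y) u v v₁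
    have h2 := hL.proxObjective_le_right (η := η) (x, y) u v v₂
    have h3 : a • (v₁ - v) + b • (v₂ - v) = 0 := by
      rw [smul_sub, smul_sub, sub_add_sub_comm, ← add_smul, hab, one_smul, hv, sub_self]
    have h4 := congrArg (inner ℝ (gradY L (u, v) - η • (v - y))) h3
    rw [inner_add_right, real_inner_smul_right, real_inner_smul_right, inner_zero_right] at h4
    have p1 : 0 ≤ σ / 2 * ‖v₁ - v‖ ^ 2 := by positivity
    have p2 : 0 ≤ σ / 2 * ‖v₂ - v‖ ^ 2 := by positivity
    have h1' := mul_le_mul_of_nonneg_left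
      (show M (u, v₁) ≤ M (u, v) + inner ℝ (gradY L (u, v) - η • (v - y)) (v₁ - v) by
        linarith) ha
    have h2' := mul_le_mul_of_nonneg_left
      (show M (u, v₂) ≤ M (u, v) + inner ℝ (gradY L (u, v) - η • (v - y)) (v₂ - v) by
        linarith) hb
    have h5 : a * M (u, v) + b * M (u, v) = M (u, v) := by rw [← add_mul, hab, one_mul]
    simp only [smul_eq_mul]
    linarith
  set G₁ := ‖gradX L (x, y)‖
  set G₂ := ‖gradY L (x, y)‖
  -- The first term bounds the distance of the saddle point from (x, y), whatever the radius; the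
  -- extra 1 makes the point interior.
  set r := 2 / σ * (G₁ + G₂) + 1
  have hr0 : 0 ≤ r := by positivity
  obtain ⟨u, hu, v, hv, hs⟩ := Sion.exists_isSaddlePointOn (f := fun u v => M (u, v))
    (X := Metric.closedBall x r) (Y := Metric.closedBall y r)
    ⟨x, Metric.mem_closedBall_self hr0⟩ (convex_closedBall x r) (isCompact_closedBall x r)
    (fun v _ => (hleft v).continuousOn.lowerSemicontinuousOn)
    (fun v _ => ((hconv v).subset (Set.subset_univ _) (convex_closedBall x r)).quasiconvexOn)
    (convex_closedBall y r) ⟨y, Metric.mem_closedBall_self hr0⟩ (isCompact_closedBall y r)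
    (fun u _ => (hright u).continuousOn.upperSemicontinuousOn)
    (fun u _ => ((hconc u).subset (Set.subset_univ _) (convex_closedBall y r)).quasiconcaveOn)
  -- Testing the saddle point against the center gives M(u, y) ≤ M(x, v). The two strong
  -- inequalities at the center turn this into a quadratic bounded by a linear term.
  have hxy := hs x (Metric.mem_closedBall_self hr0) y (Metric.mem_closedBall_self hr0)
  have h1 := hL.proxObjective_le_left (η := η) (x, y) x u y
  have h2 := hL.proxObjective_le_right (η := η) (x, y) x y v
  simp only [sub_self, smul_zero, add_zero, sub_zero] at h1 h2
  have h3 := neg_le_of_abs_le (abs_real_inner_le_norm (gradX L (x, y)) (u - x))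
  have h4 := le_of_abs_le (abs_real_inner_le_norm (gradY L (x, y)) (v - y))
  have key : σ / 2 * (‖u - x‖ ^ 2 + ‖v - y‖ ^ 2) ≤ G₁ * ‖u - x‖ + G₂ * ‖v - y‖ := by
    change M (u, y) ≤ M (x, v) at hxy
    linarith
  have key2 : ‖u - x‖ ^ 2 + ‖v - y‖ ^ 2 ≤ (2 / σ * (G₁ + G₂)) ^ 2 := by
    have hG₁ : 0 ≤ G₁ := norm_nonneg _
    have hG₂ : 0 ≤ G₂ := norm_nonneg _
    rw [mul_pow, div_pow, div_mul_eq_mul_div, le_div_iff₀ (by positivity)]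
    nlinarith [sq_nonneg (σ * ‖u - x‖ - 2 * G₁), sq_nonneg (σ * ‖v - y‖ - 2 * G₂),
      mul_nonneg hG₁ hG₂]
  have hK : 0 ≤ 2 / σ * (G₁ + G₂) := by positivity
  have hu' : ‖u - x‖ < r := by
    have := abs_le_of_sq_le_sq' (a := ‖u - x‖) (by nlinarith [sq_nonneg ‖v - y‖]) hK
    simp only [r]; linarith [this.2]
  have hv' : ‖v - y‖ < r := by
    have := abs_le_of_sq_le_sq' (a := ‖v - y‖) (by nlinarith [sq_nonneg ‖u - x‖]) hK
    simp only [r]; linarith [this.2]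
  refine ⟨(u, v), ?_, ?_⟩
  · refine IsLocalMin.hasGradientAt_eq_zero ?_ (hasGradientAt_proxObjective_left hd (x, y) u v)
    filter_upwards [Metric.closedBall_mem_nhds_of_mem (mem_ball_iff_norm.2 hu')] with u' hu'
    exact hs u' hu' v hv
  · refine IsLocalMax.hasGradientAt_eq_zero ?_ (hasGradientAt_proxObjective_right hd (x, y) u v)
    filter_upwards [Metric.closedBall_mem_nhds_of_mem (mem_ball_iff_norm.2 hv')] with v' hv'
    exact hs u hu v' hv'

theorem IsProxStationary.iSup_eq (hL : IsWeaklyConvexWeaklyConcave ρ L) (hρη : ρ < η)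
    {z w : Eu n × Eu m} (hw : IsProxStationary L η z w) :
    (⨆ v : Eu m, (proxObjective L η z (w.1, v) : EReal)) = proxObjective L η z w := by
  have hσ : 0 < η - ρ := sub_pos.2 hρη
  refine le_antisymm (iSup_le fun v => EReal.coe_le_coe_iff.2 ?_)
    (le_iSup (fun v : Eu m => (proxObjective L η z (w.1, v) : EReal)) w.2)
  have := hw.add_le' hL v
  have : 0 ≤ (η - ρ) / 2 * ‖v - w.2‖ ^ 2 := by positivity
  linarith

theorem IsProxStationary.le_iSup (hL : IsWeaklyConvexWeaklyConcave ρ L) (hρη : ρ < η)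
    {z w : Eu n × Eu m} (hw : IsProxStationary L η z w) (u : Eu n) :
    (proxObjective L η z w : EReal) ≤ ⨆ v : Eu m, (proxObjective L η z (u, v) : EReal) := by
  have hσ : 0 < η - ρ := sub_pos.2 hρη
  refine le_trans (EReal.coe_le_coe_iff.2 ?_)
    (_root_.le_iSup (fun v : Eu m => (proxObjective L η z (u, v) : EReal)) w.2)
  have := hw.add_le hL u
  have : 0 ≤ (η - ρ) / 2 * ‖u - w.1‖ ^ 2 := by positivity
  linarith

theorem IsProxStationary.isMinimaxPoint (hL : IsWeaklyConvexWeaklyConcave ρ L) (hρη : ρ < η)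
    {z w : Eu n × Eu m} (hw : IsProxStationary L η z w) :
    IsMinimaxPoint (proxObjective L η z) w := by
  have hσ : 0 < η - ρ := sub_pos.2 hρη
  refine ⟨fun u => (hw.iSup_eq hL hρη).trans_le (hw.le_iSup hL hρη u), fun v => ?_⟩
  have := hw.add_le' hL v
  have : 0 ≤ (η - ρ) / 2 * ‖v - w.2‖ ^ 2 := by positivity
  linarith

theorem IsProxStationary.eq_of_isMinimaxPoint (hL : IsWeaklyConvexWeaklyConcave ρ L)
    (hρη : ρ < η) {z w w' : Eu n × Eu m} (hw : IsProxStationary L η z w)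
    (hw' : IsMinimaxPoint (proxObjective L η z) w') : w' = w := by
  have hσ : 0 < η - ρ := sub_pos.2 hρη
  have h1 : proxObjective L η z (w'.1, w.2) ≤ proxObjective L η z w := by
    have h := (_root_.le_iSup (fun v : Eu m => (proxObjective L η z (w'.1, v) : EReal)) w.2).trans
      ((hw'.1 w.1).trans_eq (hw.iSup_eq hL hρη))
    exact EReal.coe_le_coe_iff.1 h
  have hfst : w'.1 = w.1 := by
    have h2 := hw.add_le hL w'.1
    have h3 : ‖w'.1 - w.1‖ ^ 2 ≤ 0 := by
      by_contra! h
      nlinarith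
    exact sub_eq_zero.1 (norm_eq_zero.1 (pow_eq_zero_iff two_ne_zero |>.1
      (le_antisymm h3 (sq_nonneg _))))
  have hsnd : w'.2 = w.2 := by
    have h2 := hw.add_le' hL w'.2
    have h4 := hw'.2 w.2
    rw [← hfst] at h2
    rw [show ((w'.1, w'.2) : Eu n × Eu m) = w' from rfl] at h2
    rw [show ((w'.1, w.2) : Eu n × Eu m) = w by rw [hfst]] at h4
    have h3 : ‖w'.2 - w.2‖ ^ 2 ≤ 0 := by
      by_contra! h
      nlinarith
    exact sub_eq_zero.1 (norm_eq_zero.1 (pow_eq_zero_iff two_ne_zero |>.1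
      (le_antisymm h3 (sq_nonneg _))))
  exact Prod.ext hfst hsnd

/-- The proximal operator is well defined. -/
theorem existsUnique_isMinimaxPoint (hL : IsWeaklyConvexWeaklyConcave ρ L) (hρη : ρ < η)
    (z : Eu n × Eu m) : ∃! w, IsMinimaxPoint (proxObjective L η z) w := by
  obtain ⟨w, hw⟩ := exists_isProxStationary hL hρη z
  exact ⟨w, hw.isMinimaxPoint hL hρη, fun w' hw' => hw.eq_of_isMinimaxPoint hL hρη hw'⟩

/-- Uniqueness removes the arbitrariness of `Classical.epsilon`: the selected minimax point must be
the stationary one. -/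
theorem isProxStationary_prox (hL : IsWeaklyConvexWeaklyConcave ρ L) (hρη : ρ < η)
    (z : Eu n × Eu m) : IsProxStationary L η z (prox L η z) := by
  obtain ⟨w, hw⟩ := exists_isProxStationary hL hρη z
  have h : IsMinimaxPoint (proxObjective L η z) (prox L η z) :=
    Classical.epsilon_spec ⟨w, hw.isMinimaxPoint hL hρη⟩
  rwa [hw.eq_of_isMinimaxPoint hL hρη h]

theorem saddleEnvelope_eq (hL : IsWeaklyConvexWeaklyConcave ρ L) (hρη : ρ < η)
    (z : Eu n × Eu m) : saddleEnvelope L η z = proxObjective L η z (prox L η z) := by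
  have hw := isProxStationary_prox hL hρη z
  refine le_antisymm ((iInf_le _ (prox L η z).1).trans_eq (hw.iSup_eq hL hρη))
    (le_iInf fun u => hw.le_iSup hL hρη u)

end ProxExistence

/-! ### Lipschitz continuity, differentiability and dual contraction of the prox. -/

section ProxRegularity

variable {n m : ℕ} {L : Eu n × Eu m → ℝ} {ρ η α K : ℝ}

theorem gradX_prox (hL : IsWeaklyConvexWeaklyConcave ρ L) (hρη : ρ < η) (z : Eu n × Eu m) :
    gradX L (prox L η z) = η • (z.1 - (prox L η z).1) := by
  have := (isProxStationary_prox hL hρη z).1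
  rw [eq_neg_of_add_eq_zero_left this, ← smul_neg, neg_sub]

theorem gradY_prox (hL : IsWeaklyConvexWeaklyConcave ρ L) (hρη : ρ < η) (z : Eu n × Eu m) :
    gradY L (prox L η z) = η • ((prox L η z).2 - z.2) :=
  sub_eq_zero.1 (isProxStationary_prox hL hρη z).2

/-- Going around the rectangle (u,v), (u',v), (u',v'), (u,v') with the four weak convexity and
concavity inequalities cancels every value of L. Stationarity turns the remaining gradients into
differences of z and its prox. -/
theorem prox_strongly_monotone (hL : IsWeaklyConvexWeaklyConcave ρ L) (hρη : ρ < η)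
    (z z' : Eu n × Eu m) :
    (η - ρ) * (‖(prox L η z').1 - (prox L η z).1‖ ^ 2 +
        ‖(prox L η z').2 - (prox L η z).2‖ ^ 2) ≤
      η * (inner ℝ (z'.1 - z.1) ((prox L η z').1 - (prox L η z).1) +
        inner ℝ (z'.2 - z.2) ((prox L η z').2 - (prox L η z).2)) := by
  have hgX := gradX_prox hL hρη z
  have hgY := gradY_prox hL hρη z
  have hgX' := gradX_prox hL hρη z'
  have hgY' := gradY_prox hL hρη z'
  obtain ⟨x, y⟩ := z
  obtain ⟨x', y'⟩ := z'
  generalize prox L η (x, y) = w at *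
  generalize prox L η (x', y') = w' at *
  obtain ⟨u, v⟩ := w
  obtain ⟨u', v'⟩ := w'
  have h1 := hL.le_left u u' v
  have h2 := hL.le_left u' u v'
  have h3 := hL.le_right u v v'
  have h4 := hL.le_right u' v' v
  simp only at hgX hgY hgX' hgY'
  rw [hgX, real_inner_smul_left] at h1
  rw [hgX', real_inner_smul_left, ← neg_sub u' u, inner_neg_right, norm_neg] at h2
  rw [hgY, real_inner_smul_left] at h3
  rw [hgY', real_inner_smul_left, ← neg_sub v' v, inner_neg_right, norm_neg] at h4
  have e1 : inner ℝ (x - u) (u' - u) - inner ℝ (x' - u') (u' - u) =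
      ‖u' - u‖ ^ 2 - inner ℝ (x' - x) (u' - u) := by
    rw [← inner_sub_left, ← real_inner_self_eq_norm_sq, ← inner_sub_left]
    congr 1; abel
  have e2 : inner ℝ (v - y) (v' - v) - inner ℝ (v' - y') (v' - v) =
      inner ℝ (y' - y) (v' - v) - ‖v' - v‖ ^ 2 := by
    rw [← inner_sub_left, ← real_inner_self_eq_norm_sq, ← inner_sub_left]
    congr 1; abel
  have e3 := congrArg (η * ·) e1
  have e4 := congrArg (η * ·) e2
  simp only [mul_sub] at e3 e4
  simp only
  linarith

/-- The proximal operator is Lipschitz for the Euclidean norm of the product. -/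
theorem prox_lipschitz (hL : IsWeaklyConvexWeaklyConcave ρ L) (hη : 0 < η) (hρη : ρ < η)
    (hK : η ≤ K * (η - ρ)) (z z' : Eu n × Eu m) :
    ‖(prox L η z').1 - (prox L η z).1‖ ^ 2 + ‖(prox L η z').2 - (prox L η z).2‖ ^ 2 ≤
      K ^ 2 * (‖z'.1 - z.1‖ ^ 2 + ‖z'.2 - z.2‖ ^ 2) := by
  have h := prox_strongly_monotone hL hρη z z'
  have hσ : 0 < η - ρ := sub_pos.2 hρη
  have h1 := real_inner_le_norm (z'.1 - z.1) ((prox L η z').1 - (prox L η z).1)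
  have h2 := real_inner_le_norm (z'.2 - z.2) ((prox L η z').2 - (prox L η z).2)
  set A := ‖(prox L η z').1 - (prox L η z).1‖
  set B := ‖(prox L η z').2 - (prox L η z).2‖
  set P := ‖z'.1 - z.1‖
  set Q := ‖z'.2 - z.2‖
  have hA : 0 ≤ A := norm_nonneg _
  have hB : 0 ≤ B := norm_nonneg _
  have hP : 0 ≤ P := norm_nonneg _
  have hQ : 0 ≤ Q := norm_nonneg _
  have h3 : (η - ρ) * (A ^ 2 + B ^ 2) ≤ (η - ρ) * (K * (P * A + Q * B)) := by
    have i1 : η * (P * A + Q * B) ≤ K * (η - ρ) * (P * A + Q * B) :=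
      mul_le_mul_of_nonneg_right hK (by positivity)
    have i2 := mul_le_mul_of_nonneg_left (add_le_add h1 h2) hη.le
    linarith
  have h4 := le_of_mul_le_mul_left h3 hσ
  nlinarith [sq_nonneg (K * P - A), sq_nonneg (K * Q - B)]

theorem continuous_prox (hL : IsWeaklyConvexWeaklyConcave ρ L) (hη : 0 < η) (hρη : ρ < η) :
    Continuous (prox L η) := by
  have hσ : 0 < η - ρ := sub_pos.2 hρη
  rw [continuous_iff_continuousAt]
  intro z
  have h : Tendsto (fun z' : Eu n × Eu m => (η / (η - ρ)) ^ 2 *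
      (‖z'.1 - z.1‖ ^ 2 + ‖z'.2 - z.2‖ ^ 2)) (𝓝 z) (𝓝 0) := by
    have : Continuous fun z' : Eu n × Eu m => (η / (η - ρ)) ^ 2 *
      (‖z'.1 - z.1‖ ^ 2 + ‖z'.2 - z.2‖ ^ 2) := by fun_prop
    simpa using this.tendsto z
  have hlip := prox_lipschitz (K := η / (η - ρ)) hL hη hρη
    (by rw [div_mul_cancel₀ _ hσ.ne']) z
  have hsq : ∀ {k : ℕ} (f : Eu n × Eu m → Eu k) (a : Eu k),
      (∀ z', ‖f z' - a‖ ^ 2 ≤ (η / (η - ρ)) ^ 2 * (‖z'.1 - z.1‖ ^ 2 + ‖z'.2 - z.2‖ ^ 2)) →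
      Tendsto f (𝓝 z) (𝓝 a) := by
    intro k f a hf
    rw [tendsto_iff_norm_sub_tendsto_zero]
    have := (squeeze_zero (fun z' => sq_nonneg _) hf h).sqrt
    simpa using this
  exact (hsq (fun z' => (prox L η z').1) _ fun z' =>
    (le_add_of_nonneg_right (sq_nonneg _)).trans (hlip z')).prodMk_nhds
    (hsq (fun z' => (prox L η z').2) _ fun z' =>
      (le_add_of_nonneg_left (sq_nonneg _)).trans (hlip z'))

/-- The proximal operator is differentiable; its derivative solves the linearized stationarity
system. -/
theorem exists_hasFDerivAt_prox (hL : IsWeaklyConvexWeaklyConcave ρ L) (hη : 0 < η) (hρη : ρ < η)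
    (z : Eu n × Eu m) :
    ∃ D : Eu n × Eu m →L[ℝ] Eu n × Eu m, HasFDerivAt (prox L η) D z ∧ ∀ h,
      hessXX L (prox L η z) (D h).1 + hessXY L (prox L η z) (D h).2 + η • (D h).1 = η • h.1 ∧
      η • (D h).2 - (hessYX L (prox L η z) (D h).1 + hessYY L (prox L η z) (D h).2) =
        η • h.2 := by
  have hσ : 0 < η - ρ := sub_pos.2 hρη
  have hT := hL.twiceDifferentiable
  set w := prox L η z with hw
  set F : Eu n × Eu m → Eu n × Eu m :=
    fun w => (η⁻¹ • gradX L w + w.1, w.2 - η⁻¹ • gradY L w) with hF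
  set A : Eu n × Eu m →L[ℝ] Eu n × Eu m :=
    (η⁻¹ • fderiv ℝ (gradX L) w + .fst ℝ _ _).prod (.snd ℝ _ _ - η⁻¹ • fderiv ℝ (gradY L) w)
    with hA
  have hFA : HasFDerivAt F A w :=
    (((differentiable_gradX hT w).hasFDerivAt.const_smul η⁻¹).add hasFDerivAt_fst).prodMk
      (hasFDerivAt_snd.sub ((differentiable_gradY hT w).hasFDerivAt.const_smul η⁻¹))
  have hA1 : ∀ h, η • (A h).1 = hessXX L w h.1 + hessXY L w h.2 + η • h.1 := by
    rintro ⟨p, q⟩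
    simp only [hA, ContinuousLinearMap.prod_apply, add_apply,
      smul_apply, ContinuousLinearMap.coe_fst', smul_add,
      smul_inv_smul₀ hη.ne', fderiv_gradX_apply hT]
  have hA2 : ∀ h, η • (A h).2 = η • h.2 - (hessYX L w h.1 + hessYY L w h.2) := by
    rintro ⟨p, q⟩
    simp only [hA, ContinuousLinearMap.prod_apply, sub_apply,
      smul_apply, ContinuousLinearMap.coe_snd', smul_sub,
      smul_inv_smul₀ hη.ne', fderiv_gradY_apply hT]
  -- Pairing the two rows with p and q and adding cancels the mixed blocks by symmetry, leaving a
  -- form bounded below by (η − ρ)(‖p‖² + ‖q‖²).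
  have hinj : Function.Injective A.toLinearMap := by
    refine (injective_iff_map_eq_zero _).2 fun ⟨p, q⟩ h0 => ?_
    have h0 : A (p, q) = 0 := h0
    have h1 := hA1 (p, q)
    have h2 := hA2 (p, q)
    rw [h0] at h1 h2
    have h1 := congrArg (inner ℝ · p) h1
    have h2 := congrArg (inner ℝ · q) h2
    have hx := hL.weaklyConvex w p
    have hy := hL.weaklyConcave w q
    simp only [Prod.fst_zero, Prod.snd_zero, smul_zero, inner_zero_left, inner_add_left,
      inner_sub_left, real_inner_smul_left, real_inner_self_eq_norm_sq,
      neg_apply, inner_neg_left] at h1 h2 hx hy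
    have hsym := inner_hessXY_eq_inner_hessYX hT w p q
    have hsum : (η - ρ) * (‖p‖ ^ 2 + ‖q‖ ^ 2) ≤ 0 := by linarith
    have hsum' : ‖p‖ ^ 2 + ‖q‖ ^ 2 ≤ 0 := by
      by_contra! h
      nlinarith
    have hp : ‖p‖ ^ 2 = 0 := by nlinarith [sq_nonneg ‖p‖, sq_nonneg ‖q‖]
    have hq : ‖q‖ ^ 2 = 0 := by nlinarith [sq_nonneg ‖p‖, sq_nonneg ‖q‖]
    simpa using And.intro hp hq
  set e : (Eu n × Eu m) ≃L[ℝ] (Eu n × Eu m) :=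
    (LinearEquiv.ofInjectiveEndo A.toLinearMap hinj).toContinuousLinearEquiv with he
  have heA : (e : Eu n × Eu m →L[ℝ] Eu n × Eu m) = A :=
    ContinuousLinearMap.ext fun _ => rfl
  -- Stationarity says F ∘ prox = id. With continuity of the prox already known, this gives the
  -- derivative without the continuously differentiable F of the usual inverse function theorem.
  have hright : ∀ z', F (prox L η z') = z' := by
    intro z'
    simp only [hF, gradX_prox hL hρη z', gradY_prox hL hρη z', inv_smul_smul₀ hη.ne']
    ext1 <;> simp
  refine ⟨e.symm, HasFDerivAt.of_local_left_inverse (f := F)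
    (continuous_prox hL hη hρη).continuousAt (heA ▸ hFA) (Eventually.of_forall hright),
    fun h => ?_⟩
  have hAe : A (e.symm h) = h := by
    rw [← heA]
    exact e.apply_symm_apply h
  constructor
  · exact (hA1 (e.symm h)).symm.trans (by rw [hAe])
  · exact (hA2 (e.symm h)).symm.trans (by rw [hAe])

/-- `Ring.inverse` is 0 on non-units; this makes it the genuine inverse in the interaction dominance
condition. -/
theorem isUnit_smul_one_add_hessXX (hL : IsWeaklyConvexWeaklyConcave ρ L) (hρη : ρ < η)
    (w : Eu n × Eu m) : IsUnit (η • (1 : Eu n →L[ℝ] Eu n) + hessXX L w) := by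
  have hinj : Function.Injective (η • (1 : Eu n →L[ℝ] Eu n) + hessXX L w) := by
    refine (injective_iff_map_eq_zero _).2 fun p h0 => ?_
    have h := congrArg (inner ℝ · p) h0
    have hx := hL.weaklyConvex w p
    simp only [add_apply, smul_apply,
      one_apply_eq_self, inner_add_left, real_inner_smul_left,
      real_inner_self_eq_norm_sq, inner_zero_left] at h
    have hp : ‖p‖ ^ 2 = 0 := by
      by_contra hne
      have : 0 < ‖p‖ ^ 2 := lt_of_le_of_ne (sq_nonneg _) (Ne.symm hne)
      nlinarith
    simpa using hp
  exact ContinuousLinearMap.isUnit_iff_bijective.2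
    ⟨hinj, LinearMap.surjective_of_injective
      (f := (η • (1 : Eu n →L[ℝ] Eu n) + hessXX L w).toLinearMap) hinj⟩

/-- Interaction dominance makes the dual component of the proximal operator a contraction in `y`. -/
theorem norm_prox_snd_sub_le (hL : IsWeaklyConvexWeaklyConcave ρ L)
    (hα : IsInteractionDominantInY η α L) (hη : 0 < η) (hρη : ρ < η) (hα0 : 0 < α)
    (x : Eu n) (y y' : Eu m) :
    ‖(prox L η (x, y')).2 - (prox L η (x, y)).2‖ ≤ η / (η + α) * ‖y' - y‖ := by
  choose D hD hsys using exists_hasFDerivAt_prox hL hη hρη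
  have hderiv : ∀ y : Eu m, HasFDerivAt (fun y => (prox L η (x, y)).2)
      ((ContinuousLinearMap.snd ℝ _ _).comp ((D (x, y)).comp (.inr ℝ _ _))) y := fun y =>
    hasFDerivAt_snd.comp y ((hD (x, y)).comp y (hasFDerivAt_prodMk_right x y))
  refine Convex.norm_image_sub_le_of_norm_hasFDerivWithin_le
    (fun y _ => (hderiv y).hasFDerivWithinAt) (fun y _ => ?_) convex_univ
    (Set.mem_univ y) (Set.mem_univ y')
  refine ContinuousLinearMap.opNorm_le_bound _ (by positivity) fun k => ?_
  have h1 := (hsys (x, y) (0, k)).1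
  have h2 := (hsys (x, y) (0, k)).2
  change ‖(D (x, y) (0, k)).2‖ ≤ _
  set p := (D (x, y) (0, k)).1
  set q := (D (x, y) (0, k)).2
  set w := prox L η (x, y)
  set T := η • (1 : Eu n →L[ℝ] Eu n) + hessXX L w with hT
  have hTp : T p = -hessXY L w q := by
    rw [eq_neg_iff_add_eq_zero, hT]
    simp only [smul_zero] at h1
    rw [← h1]
    simp only [add_apply, smul_apply,
      one_apply_eq_self]
    abel
  -- Solving the primal row for p leaves the Schur complement acting on q, whose form is at least (η
  -- + α)‖q‖².
  have hp : p = -Ring.inverse T (hessXY L w q) := by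
    have : (Ring.inverse T * T) p = p := by
      rw [Ring.inverse_mul_cancel _ (isUnit_smul_one_add_hessXX hL hρη w)]
      rfl
    rw [← this, mul_apply_eq_comp, hTp, map_neg]
  have hdom := hα w q
  simp only [add_apply, neg_apply,
    ContinuousLinearMap.comp_apply, ← hT] at hdom
  have h3 := congrArg (inner ℝ · q) h2
  rw [hp] at h3
  simp only [map_neg, inner_add_left, inner_sub_left, inner_neg_left, real_inner_smul_left,
    real_inner_self_eq_norm_sq] at h3 hdom
  have hcs := mul_le_mul_of_nonneg_left (real_inner_le_norm k q) hη.le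
  have hfin : (η + α) * ‖q‖ ^ 2 ≤ η * (‖k‖ * ‖q‖) := by linarith
  rw [div_mul_eq_mul_div, le_div_iff₀ (by positivity)]
  rcases (norm_nonneg q).eq_or_lt with h0 | h0
  · rw [← h0]; simp; positivity
  · nlinarith

end ProxRegularity

/-- Over N + 1 equal subintervals of [0, 1] the quadratic errors add up to C/(N + 1), which tends to
0. -/
theorem le_of_forall_sub_le_mul_sq {h : ℝ → ℝ} {C : ℝ}
    (hh : ∀ t t', 0 ≤ t → t ≤ t' → h t' - h t ≤ C * (t' - t) ^ 2) : h 1 ≤ h 0 := by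
  have key : ∀ N : ℕ, h 1 - h 0 ≤ C * (1 / ((N : ℝ) + 1)) := by
    intro N
    have hN : (0 : ℝ) < (N : ℝ) + 1 := by positivity
    have h1 := Finset.sum_range_sub (fun j : ℕ => h (j / ((N : ℝ) + 1))) (N + 1)
    have h2 : ∑ j ∈ Finset.range (N + 1),
        (h ((j + 1 : ℕ) / ((N : ℝ) + 1)) - h (j / ((N : ℝ) + 1))) ≤
        ∑ _j ∈ Finset.range (N + 1), C * (1 / ((N : ℝ) + 1)) ^ 2 := by
      refine Finset.sum_le_sum fun j _ => ?_
      refine (hh _ _ (by positivity) (by gcongr; simp)).trans_eq ?_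
      push_cast
      ring
    rw [h1] at h2
    simp only [Finset.sum_const, Finset.card_range, nsmul_eq_mul] at h2
    push_cast at h2
    rw [div_self hN.ne', zero_div] at h2
    refine h2.trans_eq ?_
    field_simp
  have hlim : Tendsto (fun N : ℕ => C * (1 / ((N : ℝ) + 1))) atTop (𝓝 0) := by
    simpa using tendsto_one_div_add_atTop_nhds_zero_nat.const_mul C
  exact sub_nonpos.1 (ge_of_tendsto' hlim key)

/-! ### The saddle envelope, its dual maximizers and Lyapunov descent. -/

section Envelope

variable {n m : ℕ} {L : Eu n × Eu m → ℝ} {ρ η α K : ℝ}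

/-- The value of the saddle envelope as a real number. -/
noncomputable def saddleValue (L : Eu n × Eu m → ℝ) (η : ℝ) (z : Eu n × Eu m) : ℝ :=
  proxObjective L η z (prox L η z)

/-- Both saddle inequalities are tested at the mixed point (primal prox of z, dual prox of z'), so
the L terms cancel. This replaces differentiating the envelope. -/
theorem saddleValue_sub_le (hL : IsWeaklyConvexWeaklyConcave ρ L) (hρη : ρ < η)
    (z z' : Eu n × Eu m) :
    saddleValue L η z' - saddleValue L η z ≤
      η / 2 * (‖(prox L η z).1 - z'.1‖ ^ 2 - ‖(prox L η z).1 - z.1‖ ^ 2) +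
        η / 2 * (‖(prox L η z').2 - z.2‖ ^ 2 - ‖(prox L η z').2 - z'.2‖ ^ 2) := by
  have hσ : 0 < η - ρ := sub_pos.2 hρη
  have h1 := (isProxStationary_prox hL hρη z').add_le hL (prox L η z).1
  have h2 := (isProxStationary_prox hL hρη z).add_le' hL (prox L η z').2
  have p1 : 0 ≤ (η - ρ) / 2 * ‖(prox L η z).1 - (prox L η z').1‖ ^ 2 := by positivity
  have p2 : 0 ≤ (η - ρ) / 2 * ‖(prox L η z').2 - (prox L η z).2‖ ^ 2 := by positivity
  change saddleValue L η z' + _ ≤ _ at h1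
  change _ ≤ saddleValue L η z at h2
  simp only [proxObjective] at h1 h2
  linarith

/-- A fixed point of the dual component of the proximal operator maximizes the saddle envelope. -/
theorem saddleValue_le_of_fixed (hL : IsWeaklyConvexWeaklyConcave ρ L)
    (hα : IsInteractionDominantInY η α L) (hη : 0 < η) (hρη : ρ < η) (hα0 : 0 < α)
    {x : Eu n} {y₀ : Eu m} (hy₀ : (prox L η (x, y₀)).2 = y₀) (y : Eu m) :
    saddleValue L η (x, y) ≤ saddleValue L η (x, y₀) := by
  set k := y - y₀ with hk
  have key := le_of_forall_sub_le_mul_sq (h := fun t => saddleValue L η (x, y₀ + t • k))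
    (C := η / 2 * ‖k‖ ^ 2) fun t t' ht htt' => ?_
  · simpa [hk] using key
  have h1 := saddleValue_sub_le hL hρη (x, y₀ + t • k) (x, y₀ + t' • k)
  have h2 := norm_prox_snd_sub_le hL hα hη hρη hα0 x y₀ (y₀ + t' • k)
  have ht' : 0 ≤ t' := ht.trans htt'
  have hq : η / (η + α) ≤ 1 := by rw [div_le_one (by positivity)]; linarith
  rw [hy₀, add_sub_cancel_left, norm_smul, Real.norm_eq_abs, abs_of_nonneg ht'] at h2
  set v := (prox L η (x, y₀ + t' • k)).2
  have h3 : ‖v - y₀‖ ≤ t' * ‖k‖ := h2.trans (mul_le_of_le_one_left (by positivity) hq)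
  have h4 : inner ℝ (v - y₀) k ≤ t' * ‖k‖ * ‖k‖ :=
    (real_inner_le_norm _ _).trans (mul_le_mul_of_nonneg_right h3 (norm_nonneg _))
  -- The contraction toward y₀ means that the dual prox never overshoots in the direction k, so the
  -- envelope has no first-order increase along the ray.
  have h5 : inner ℝ (v - (y₀ + t' • k)) k ≤ 0 := by
    rw [← sub_sub, inner_sub_left, real_inner_smul_left, real_inner_self_eq_norm_sq]
    linarith
  have h6 : ‖v - (y₀ + t • k)‖ ^ 2 = ‖v - (y₀ + t' • k)‖ ^ 2 +
      2 * ((t' - t) * inner ℝ (v - (y₀ + t' • k)) k) + (t' - t) ^ 2 * ‖k‖ ^ 2 := by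
    rw [← real_inner_smul_right, ← sq_abs (t' - t), ← mul_pow, ← Real.norm_eq_abs, ← norm_smul,
      ← norm_add_sq_real]
    congr 2
    rw [sub_smul]
    abel
  have h7 : (t' - t) * inner ℝ (v - (y₀ + t' • k)) k ≤ 0 :=
    mul_nonpos_of_nonneg_of_nonpos (sub_nonneg.2 htt') h5
  have h8 := mul_nonpos_of_nonneg_of_nonpos hη.le h7
  simp only [sub_self, mul_zero, zero_add] at h1
  rw [h6] at h1
  linarith

/-- The maximizer of the saddle envelope in the dual variable. -/
theorem exists_prox_snd_fixed (hL : IsWeaklyConvexWeaklyConcave ρ L)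
    (hα : IsInteractionDominantInY η α L) (hη : 0 < η) (hρη : ρ < η) (hα0 : 0 < α) (x : Eu n) :
    ∃ y, (prox L η (x, y)).2 = y := by
  have hq : 0 ≤ η / (η + α) := by positivity
  have hc : ContractingWith (η / (η + α)).toNNReal fun y => (prox L η (x, y)).2 := by
    refine ⟨?_, LipschitzWith.of_dist_le_mul fun y y' => ?_⟩
    · rw [Real.toNNReal_lt_one, div_lt_one (by positivity)]
      linarith
    · rw [dist_eq_norm, dist_eq_norm, Real.coe_toNNReal _ hq]
      exact norm_prox_snd_sub_le hL hα hη hρη hα0 x y' y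
  exact ⟨_, hc.fixedPoint_isFixedPt⟩

theorem envelopePrimal_eq (hL : IsWeaklyConvexWeaklyConcave ρ L)
    (hα : IsInteractionDominantInY η α L) (hη : 0 < η) (hρη : ρ < η) (hα0 : 0 < α)
    {x : Eu n} {y₀ : Eu m} (hy₀ : (prox L η (x, y₀)).2 = y₀) :
    envelopePrimal L η x = saddleValue L η (x, y₀) := by
  simp only [envelopePrimal, saddleEnvelope_eq hL hρη]
  exact le_antisymm
    (iSup_le fun y => EReal.coe_le_coe_iff.2 (saddleValue_le_of_fixed hL hα hη hρη hα0 hy₀ y))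
    (le_iSup (fun y => ((proxObjective L η (x, y) (prox L η (x, y)) : ℝ) : EReal)) y₀)

theorem norm_prox_fst_sub_le (hL : IsWeaklyConvexWeaklyConcave ρ L) (hη : 0 < η) (hρη : ρ < η)
    (hK0 : 0 ≤ K) (hK : η ≤ K * (η - ρ)) (x : Eu n) (y y' : Eu m) :
    ‖(prox L η (x, y')).1 - (prox L η (x, y)).1‖ ≤ K * ‖y' - y‖ := by
  have h := prox_lipschitz hL hη hρη hK (x, y) (x, y')
  simp only [sub_self, norm_zero] at h
  refine abs_le_of_sq_le_sq' (b := K * ‖y' - y‖) ?_ (by positivity) |>.2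
  nlinarith [sq_nonneg ‖(prox L η (x, y')).2 - (prox L η (x, y)).2‖]

theorem norm_prox_snd_sub_le_left (hL : IsWeaklyConvexWeaklyConcave ρ L) (hη : 0 < η)
    (hρη : ρ < η) (hK0 : 0 ≤ K) (hK : η ≤ K * (η - ρ)) (x x' : Eu n) (y : Eu m) :
    ‖(prox L η (x', y)).2 - (prox L η (x, y)).2‖ ≤ K * ‖x' - x‖ := by
  have h := prox_lipschitz hL hη hρη hK (x, y) (x', y)
  simp only [sub_self, norm_zero] at h
  refine abs_le_of_sq_le_sq' (b := K * ‖x' - x‖) ?_ (by positivity) |>.2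
  nlinarith [sq_nonneg ‖(prox L η (x', y)).1 - (prox L η (x, y)).1‖]

/-- The dual maximizer is Lipschitz in the primal variable. -/
theorem norm_fixed_sub_le (hL : IsWeaklyConvexWeaklyConcave ρ L)
    (hα : IsInteractionDominantInY η α L) (hη : 0 < η) (hρη : ρ < η) (hα0 : 0 < α)
    (hK0 : 0 ≤ K) (hK : η ≤ K * (η - ρ)) {x x' : Eu n} {y y' : Eu m}
    (hy : (prox L η (x, y)).2 = y) (hy' : (prox L η (x', y')).2 = y') :
    ‖y' - y‖ ≤ K * (1 + η / α) * ‖x' - x‖ := by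
  have h1 := norm_prox_snd_sub_le_left hL hη hρη hK0 hK x x' y'
  have h2 := norm_prox_snd_sub_le hL hα hη hρη hα0 x y y'
  have h3 := norm_sub_le_norm_sub_add_norm_sub y' (prox L η (x, y')).2 y
  rw [hy'] at h1
  rw [hy] at h2
  have h4 : α / (η + α) * ‖y' - y‖ ≤ K * ‖x' - x‖ := by
    have : α / (η + α) = 1 - η / (η + α) := by field_simp; ring
    rw [this]; linarith
  rw [div_mul_eq_mul_div, div_le_iff₀ (by positivity)] at h4
  have h5 : 1 + η / α = (η + α) / α := by field_simp; ring
  rw [h5, mul_div_assoc', div_mul_eq_mul_div, le_div_iff₀ hα0]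
  linarith

/-- The a posteriori bound for a contraction of factor η/(η + α): 1/(1 − η/(η + α)) = 1 + η/α. -/
theorem norm_sub_fixed_le (hL : IsWeaklyConvexWeaklyConcave ρ L)
    (hα : IsInteractionDominantInY η α L) (hη : 0 < η) (hρη : ρ < η) (hα0 : 0 < α)
    {x : Eu n} {ys : Eu m} (hys : (prox L η (x, ys)).2 = ys) (y : Eu m) :
    ‖y - ys‖ ≤ (1 + η / α) * ‖(prox L η (x, y)).2 - y‖ := by
  have h2 := norm_prox_snd_sub_le hL hα hη hρη hα0 x ys y
  have h3 := norm_sub_le_norm_sub_add_norm_sub y (prox L η (x, y)).2 ys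
  rw [hys] at h2
  rw [norm_sub_rev y (prox L η (x, y)).2] at h3
  have h4 : α / (η + α) * ‖y - ys‖ ≤ ‖(prox L η (x, y)).2 - y‖ := by
    have : α / (η + α) = 1 - η / (η + α) := by field_simp; ring
    rw [this]; linarith
  rw [div_mul_eq_mul_div, div_le_iff₀ (by positivity)] at h4
  have h5 : 1 + η / α = (η + α) / α := by field_simp; ring
  rw [h5, div_mul_eq_mul_div, le_div_iff₀ hα0]
  linarith

/-- The primal function descends along a damped step, up to the error in the dual variable. -/
theorem saddleValue_descent (hL : IsWeaklyConvexWeaklyConcave ρ L)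
    (hα : IsInteractionDominantInY η α L) (hη : 0 < η) (hρη : ρ < η) (hα0 : 0 < α)
    (hK0 : 0 ≤ K) (hK : η ≤ K * (η - ρ)) {lam : ℝ} (hlam : 0 ≤ lam)
    (hlamK : K ^ 2 * (1 + η / α) * lam + lam / 2 ≤ 1 / 4) {x x' : Eu n} {y ys ys' : Eu m}
    (hx' : x' = lam • (prox L η (x, y)).1 + (1 - lam) • x)
    (hys : (prox L η (x, ys)).2 = ys) (hys' : (prox L η (x', ys')).2 = ys') :
    saddleValue L η (x', ys') - saddleValue L η (x, ys) ≤
      η * lam * (K ^ 2 * ‖y - ys‖ ^ 2 - ‖x - (prox L η (x, y)).1‖ ^ 2 / 2) := by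
  set g := x - (prox L η (x, y)).1 with hg
  have hxx : x' - x = -(lam • g) := by
    rw [hx', hg]; module
  have hnx : ‖x' - x‖ = lam * ‖g‖ := by
    rw [hxx, norm_neg, norm_smul, Real.norm_eq_abs, abs_of_nonneg hlam]
  have h1 := saddleValue_sub_le hL hρη (x, ys') (x', ys')
  have h2 := saddleValue_le_of_fixed hL hα hη hρη hα0 hys ys'
  have h3 := norm_prox_fst_sub_le hL hη hρη hK0 hK x y ys'
  have h4 := norm_fixed_sub_le hL hα hη hρη hα0 hK0 hK hys hys'
  have h5 := norm_sub_le_norm_sub_add_norm_sub ys' ys y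
  rw [hnx] at h4
  rw [norm_sub_rev ys y] at h5
  set u := (prox L η (x, ys')).1
  have h6 : ‖u - x'‖ ^ 2 - ‖u - x‖ ^ 2 = 2 * lam * inner ℝ (u - x) g + lam ^ 2 * ‖g‖ ^ 2 := by
    have e : u - x' = (u - x) + lam • g := by
      rw [← neg_neg (lam • g), ← hxx]; abel
    rw [e, norm_add_sq_real, real_inner_smul_right, norm_smul, mul_pow, Real.norm_eq_abs, sq_abs]
    ring
  -- Were u equal to the computed prox point, the inner product would be −‖g‖². The error comes from
  -- y versus ys', split into the drift of the maximizer and the current dual error.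
  have h7 : inner ℝ (u - x) g ≤ K * (K * (1 + η / α) * (lam * ‖g‖) + ‖y - ys‖) * ‖g‖
      - ‖g‖ ^ 2 := by
    have e : u - x = (u - (prox L η (x, y)).1) - g := by rw [hg]; abel
    rw [e, inner_sub_left, real_inner_self_eq_norm_sq]
    have := (real_inner_le_norm (u - (prox L η (x, y)).1) g).trans
      (mul_le_mul_of_nonneg_right (h3.trans (mul_le_mul_of_nonneg_left
        (h5.trans (add_le_add_left h4 _)) hK0)) (norm_nonneg g))
    linarith
  simp only [sub_self, mul_zero, add_zero] at h1
  rw [h6] at h1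
  have h8 : inner ℝ (u - x) g + lam / 2 * ‖g‖ ^ 2 ≤ K ^ 2 * ‖y - ys‖ ^ 2 - ‖g‖ ^ 2 / 2 := by
    have h9 := mul_le_mul_of_nonneg_right hlamK (sq_nonneg ‖g‖)
    have h10 : K * ‖y - ys‖ * ‖g‖ ≤ K ^ 2 * ‖y - ys‖ ^ 2 + ‖g‖ ^ 2 / 4 := by
      linarith [sq_nonneg (K * ‖y - ys‖ - ‖g‖ / 2)]
    linarith
  have h9 := mul_le_mul_of_nonneg_left h8 (mul_nonneg hη.le hlam)
  linarith

/-- Recursion for the distance to the dual maximizer along a damped step. -/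
theorem norm_sub_fixed_step (hL : IsWeaklyConvexWeaklyConcave ρ L)
    (hα : IsInteractionDominantInY η α L) (hη : 0 < η) (hρη : ρ < η) (hα0 : 0 < α)
    (hK0 : 0 ≤ K) (hK : η ≤ K * (η - ρ)) {lam gam : ℝ} (hlam : 0 ≤ lam) (hgam : 0 ≤ gam)
    (hgam1 : gam ≤ 1) {x x' : Eu n} {y y' ys ys' : Eu m}
    (hx' : x' = lam • (prox L η (x, y)).1 + (1 - lam) • x)
    (hy' : y' = gam • (prox L η (x, y)).2 + (1 - gam) • y)
    (hys : (prox L η (x, ys)).2 = ys) (hys' : (prox L η (x', ys')).2 = ys') :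
    ‖y' - ys'‖ ≤ (1 - gam / (1 + η / α)) * ‖y - ys‖ +
      K * (1 + η / α) * lam * ‖x - (prox L η (x, y)).1‖ := by
  have hxx : x' - x = -(lam • (x - (prox L η (x, y)).1)) := by
    rw [hx']; module
  have h1 := norm_fixed_sub_le hL hα hη hρη hα0 hK0 hK hys hys'
  rw [hxx, norm_neg, norm_smul, Real.norm_eq_abs, abs_of_nonneg hlam] at h1
  have h2 := norm_prox_snd_sub_le hL hα hη hρη hα0 x ys y
  rw [hys] at h2
  have h3 := norm_sub_le_norm_sub_add_norm_sub y' ys ys'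
  have h4 : ‖y' - ys‖ ≤ gam * (η / (η + α) * ‖y - ys‖) + (1 - gam) * ‖y - ys‖ := by
    have e : y' - ys = gam • ((prox L η (x, y)).2 - ys) + (1 - gam) • (y - ys) := by
      rw [hy']; module
    rw [e]
    refine (norm_add_le _ _).trans ?_
    rw [norm_smul, norm_smul, Real.norm_eq_abs, Real.norm_eq_abs, abs_of_nonneg hgam,
      abs_of_nonneg (sub_nonneg.2 hgam1)]
    gcongr
  have e : gam / (1 + η / α) = gam * (1 - η / (η + α)) := by field_simp; ring
  rw [norm_sub_rev ys ys'] at h3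
  rw [e]
  linarith

theorem gradNorm_prox_sq (hL : IsWeaklyConvexWeaklyConcave ρ L) (hρη : ρ < η)
    (z : Eu n × Eu m) :
    gradNorm L (prox L η z) ^ 2 =
      η ^ 2 * (‖z.1 - (prox L η z).1‖ ^ 2 + ‖(prox L η z).2 - z.2‖ ^ 2) := by
  rw [gradNorm, Real.sq_sqrt (by positivity), gradX_prox hL hρη, gradY_prox hL hρη, norm_smul,
    norm_smul, mul_pow, mul_pow, Real.norm_eq_abs, sq_abs]
  ring

/-- One step of the damped method decreases a Lyapunov function by a multiple of the squared
gradient norm. -/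
theorem lyapunov_step (hL : IsWeaklyConvexWeaklyConcave ρ L)
    (hα : IsInteractionDominantInY η α L) (hη : 0 < η) (hρη : ρ < η) (hα0 : 0 < α)
    (hK1 : 1 ≤ K) (hK : η ≤ K * (η - ρ)) {lam gam θ : ℝ} (hlam : 0 ≤ lam) (hgam : 0 < gam)
    (hgam1 : gam ≤ 1) (hθ : θ = gam / (1 + η / α))
    (hlamK : K ^ 2 * (1 + η / α) * lam + lam / 2 ≤ 1 / 4)
    (hlamgam : 2 * K ^ 4 * (1 + η / α) ^ 2 * lam ^ 2 ≤ θ ^ 2 / 4)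
    {x x' : Eu n} {y y' ys ys' : Eu m}
    (hx' : x' = lam • (prox L η (x, y)).1 + (1 - lam) • x)
    (hy' : y' = gam • (prox L η (x, y)).2 + (1 - gam) • y)
    (hys : (prox L η (x, ys)).2 = ys) (hys' : (prox L η (x', ys')).2 = ys') :
    lam * gradNorm L (prox L η (x, y)) ^ 2 ≤
      4 * η * ((saddleValue L η (x, ys) + η * lam * (2 * K ^ 2 / θ) * ‖y - ys‖ ^ 2) -
        (saddleValue L η (x', ys') + η * lam * (2 * K ^ 2 / θ) * ‖y' - ys'‖ ^ 2)) := by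
  have hK0 : 0 ≤ K := by linarith
  have hD1 : 1 ≤ 1 + η / α := le_add_of_nonneg_right (by positivity)
  have hθ0 : 0 < θ := by rw [hθ]; positivity
  have hθ1 : θ ≤ 1 := by rw [hθ, div_le_one (by positivity)]; linarith
  have h1 := saddleValue_descent hL hα hη hρη hα0 hK0 hK hlam hlamK hx' hys hys'
  have h2 := norm_sub_fixed_step hL hα hη hρη hα0 hK0 hK hlam hgam.le hgam1 hx' hy' hys hys'
  have h3 := gradNorm_prox_sq hL hρη (x, y)
  rw [← hθ] at h2
  set D := 1 + η / α
  have h4 : ‖(prox L η (x, y)).2 - y‖ ≤ 2 * ‖y - ys‖ := by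
    have i1 := norm_prox_snd_sub_le hL hα hη hρη hα0 x ys y
    rw [hys] at i1
    have hq : η / (η + α) ≤ 1 := by rw [div_le_one (by positivity)]; linarith
    have i2 := norm_sub_le_norm_sub_add_norm_sub (prox L η (x, y)).2 ys y
    rw [norm_sub_rev ys y] at i2
    nlinarith [norm_nonneg (y - ys)]
  simp only at h3
  set d := ‖y - ys‖
  set d' := ‖y' - ys'‖
  set G := ‖x - (prox L η (x, y)).1‖
  set r := ‖(prox L η (x, y)).2 - y‖
  have hd : 0 ≤ d := norm_nonneg _
  have hd' : 0 ≤ d' := norm_nonneg _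
  have hG : 0 ≤ G := norm_nonneg _
  have hr : 0 ≤ r := norm_nonneg _
  set e := K * D * lam * G with he
  have he0 : 0 ≤ e := by positivity
  -- Convexity of the square, ((1−θ)d + e)² ≤ (1−θ)d² + e²/θ, multiplied by θ.
  have h5 : θ * d' ^ 2 ≤ θ * (1 - θ) * d ^ 2 + e ^ 2 := by
    have i1 : d' ^ 2 ≤ ((1 - θ) * d + e) ^ 2 := pow_le_pow_left₀ hd' h2 2
    have i2 := mul_le_mul_of_nonneg_left i1 hθ0.le
    have i3 := mul_nonneg (sub_nonneg.2 hθ1) (sq_nonneg (θ * d - e))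
    linarith
  have h6 : 2 * K ^ 2 * e ^ 2 ≤ θ ^ 2 / 4 * G ^ 2 := by
    have := mul_le_mul_of_nonneg_right hlamgam (sq_nonneg G)
    rw [he]
    linarith
  -- The weight 2K²/θ makes the contraction gain 2K²d²: half pays for the error in the descent of Φ,
  -- half controls the dual gradient. The drift costs only G²/4 of the available G²/2.
  have h7 : 2 * K ^ 2 / θ * d' ^ 2 ≤ 2 * K ^ 2 / θ * d ^ 2 - 2 * K ^ 2 * d ^ 2 + G ^ 2 / 4 := by
    have i1 := mul_le_mul_of_nonneg_left h5 (show 0 ≤ 2 * K ^ 2 by positivity)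
    have i2 : θ ^ 2 * (2 * K ^ 2 / θ * d' ^ 2) ≤
        θ ^ 2 * (2 * K ^ 2 / θ * d ^ 2 - 2 * K ^ 2 * d ^ 2 + G ^ 2 / 4) := by
      have e1 : θ ^ 2 * (2 * K ^ 2 / θ * d' ^ 2) = 2 * K ^ 2 * (θ * d' ^ 2) := by field_simp
      have e2 : θ ^ 2 * (2 * K ^ 2 / θ * d ^ 2 - 2 * K ^ 2 * d ^ 2 + G ^ 2 / 4) =
          2 * K ^ 2 * (θ * (1 - θ) * d ^ 2) + θ ^ 2 / 4 * G ^ 2 := by field_simp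
      rw [e1, e2]
      linarith
    exact le_of_mul_le_mul_left i2 (by positivity)
  have h8 : G ^ 2 + r ^ 2 ≤ 4 * (G ^ 2 / 4 + K ^ 2 * d ^ 2) := by
    have i1 : r ^ 2 ≤ (2 * d) ^ 2 := pow_le_pow_left₀ hr h4 2
    have i2 : 1 * d ^ 2 ≤ K ^ 2 * d ^ 2 :=
      mul_le_mul_of_nonneg_right (one_le_pow₀ hK1) (sq_nonneg d)
    linarith
  have h9 := mul_le_mul_of_nonneg_left h8 (show 0 ≤ lam * η ^ 2 by positivity)
  have h10 := mul_le_mul_of_nonneg_left h7 (show 0 ≤ η * lam by positivity)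
  have h11 : η * lam * (G ^ 2 / 4 + K ^ 2 * d ^ 2) ≤
      (saddleValue L η (x, ys) + η * lam * (2 * K ^ 2 / θ) * d ^ 2) -
        (saddleValue L η (x', ys') + η * lam * (2 * K ^ 2 / θ) * d' ^ 2) := by
    linarith
  have h12 := mul_le_mul_of_nonneg_left h11 (show 0 ≤ 4 * η by positivity)
  rw [h3]
  linarith

end Envelope

/-! ### From summable squares to an iteration count, and the stepsize arithmetic. -/

theorem exists_le_div_sq_of_sum_le {f : ℕ → ℝ} {C : ℝ} (hC : 0 ≤ C)
    (hsum : ∀ N, ∑ k ∈ Finset.range N, f k ^ 2 ≤ C) {ε : ℝ} (hε : 0 < ε) :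
    ∃ T : ℕ, (T : ℝ) ≤ C / ε ^ 2 ∧ f T ≤ ε := by
  -- Indices 0, …, N give N + 1 > C/ε² terms, so they cannot all exceed ε.
  set N := ⌊C / ε ^ 2⌋₊
  have hN : (N : ℝ) ≤ C / ε ^ 2 := Nat.floor_le (by positivity)
  by_contra! h
  have h1 : ∑ _k ∈ Finset.range (N + 1), ε ^ 2 ≤ ∑ k ∈ Finset.range (N + 1), f k ^ 2 := by
    refine Finset.sum_le_sum fun k hk => ?_
    have hk : (k : ℝ) ≤ N := by exact_mod_cast Nat.lt_succ_iff.1 (Finset.mem_range.1 hk)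
    exact pow_le_pow_left₀ hε.le (h k (hk.trans hN)).le 2
  have h2 := h1.trans (hsum (N + 1))
  simp only [Finset.sum_const, Finset.card_range, nsmul_eq_mul] at h2
  rw [← le_div_iff₀ (by positivity)] at h2
  have h3 := Nat.lt_floor_add_one (C / ε ^ 2)
  push_cast at h2
  linarith

theorem le_two_div_min_mul {ρ η : ℝ} (hη : 0 < η) (hρη : ρ < η) :
    η ≤ 2 / min 1 |η / ρ - 1| * (η - ρ) := by
  have hσ : 0 < η - ρ := sub_pos.2 hρη
  rcases eq_or_ne ρ 0 with rfl | hρ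
  -- Division by zero gives η/0 = 0, so |η/ρ − 1| = 1 and the minimum is 1, as the convention for ρ
  -- = 0 requires.
  · simp; linarith
  have ht : |η / ρ - 1| = (η - ρ) / |ρ| := by
    rw [div_sub_one hρ, abs_div, abs_of_pos hσ]
  have hρ' : 0 < |ρ| := abs_pos.2 hρ
  have hs : 0 < min 1 |η / ρ - 1| := by
    rw [ht]; exact lt_min one_pos (by positivity)
  rw [div_mul_eq_mul_div, le_div_iff₀ hs]
  have h1 := min_le_left 1 |η / ρ - 1|
  have h2 := min_le_right 1 |η / ρ - 1|
  set s := min 1 |η / ρ - 1|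
  rw [ht, le_div_iff₀ hρ'] at h2
  have h3 := mul_le_mul_of_nonneg_left (le_abs_self ρ) hs.le
  have h4 := mul_le_mul_of_nonneg_right h1 hσ.le
  linarith

theorem min_one_pow_three {t : ℝ} (ht : 0 ≤ t) : min 1 (t ^ 3) = (min 1 t) ^ 3 := by
  rcases le_total t 1 with h | h
  · rw [min_eq_right h, min_eq_right (pow_le_one₀ ht h)]
  · rw [min_eq_left h, min_eq_left (one_le_pow₀ h), one_pow]

/-! ### Telescoping the Lyapunov function. -/

section Rate

variable {n m : ℕ} {L : Eu n × Eu m → ℝ} {ρ η α K : ℝ}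

/-- The squared gradient norms along the damped proximal point method are summable, with an
explicit bound. -/
theorem sum_gradNorm_sq_le (hL : IsWeaklyConvexWeaklyConcave ρ L)
    (hα : IsInteractionDominantInY η α L) (hη : 0 < η) (hρη : ρ < η) (hα0 : 0 < α)
    (hK1 : 1 ≤ K) (hK : η ≤ K * (η - ρ)) {lam gam θ : ℝ} (hlam : 0 < lam) (hgam : 0 < gam)
    (hgam1 : gam ≤ 1) (hθ : θ = gam / (1 + η / α))
    (hlamK : K ^ 2 * (1 + η / α) * lam + lam / 2 ≤ 1 / 4)
    (hlamgam : 2 * K ^ 4 * (1 + η / α) ^ 2 * lam ^ 2 ≤ θ ^ 2 / 4)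
    {x₀ : Eu n} {y₀ : Eu m} {Δ R : ℝ}
    (hΔ : ∀ x : Eu n, envelopePrimal L η x₀ ≤ envelopePrimal L η x + (Δ : EReal))
    (hR : ∀ k : ℕ, ‖(dampedPPM L η lam gam (x₀, y₀) k).2‖ ≤ R) (N : ℕ) :
    ∑ k ∈ Finset.range N, gradNorm L (prox L η (dampedPPM L η lam gam (x₀, y₀) k)) ^ 2 ≤
      4 * η / lam * (Δ + η * lam * (2 * K ^ 2 / θ) * (2 * R / θ) ^ 2) := by
  choose Y hY using exists_prox_snd_fixed hL hα hη hρη hα0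
  have hθ0 : 0 < θ := by rw [hθ]; positivity
  have hΔ' : ∀ x, saddleValue L η (x₀, Y x₀) ≤ saddleValue L η (x, Y x) + Δ := by
    intro x
    have := hΔ x
    rw [envelopePrimal_eq hL hα hη hρη hα0 (hY x₀), envelopePrimal_eq hL hα hη hρη hα0 (hY x),
      ← EReal.coe_add] at this
    exact EReal.coe_le_coe_iff.1 this
  set z := dampedPPM L η lam gam (x₀, y₀) with hz
  set V : ℕ → ℝ := fun k => saddleValue L η ((z k).1, Y (z k).1) +
    η * lam * (2 * K ^ 2 / θ) * ‖(z k).2 - Y (z k).1‖ ^ 2 with hV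
  have hstep : ∀ k, gradNorm L (prox L η (z k)) ^ 2 ≤ 4 * η / lam * (V k - V (k + 1)) := by
    intro k
    rw [div_mul_eq_mul_div, le_div_iff₀ hlam, mul_comm _ lam]
    exact lyapunov_step hL hα hη hρη hα0 hK1 hK hlam.le hgam hgam1 hθ hlamK hlamgam
      (x := (z k).1) (y := (z k).2) rfl rfl (hY _) (hY _)
  have hsum : ∑ k ∈ Finset.range N, gradNorm L (prox L η (z k)) ^ 2 ≤
      4 * η / lam * (V 0 - V N) := by
    rw [← Finset.sum_range_sub', Finset.mul_sum]
    exact Finset.sum_le_sum fun k _ => hstep k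
  refine hsum.trans (mul_le_mul_of_nonneg_left ?_ (by positivity))
  -- The first dual step has length γ‖y₀⁺ − y₀‖ ≤ 2R, which bounds the initial residual and hence
  -- the distance to the maximizer. Only the bounds on the first two dual iterates enter.
  have hdist : ‖y₀ - Y x₀‖ ≤ 2 * R / θ := by
    have h1 := norm_sub_fixed_le hL hα hη hρη hα0 (hY x₀) y₀
    have h2 : (z 1).2 - (z 0).2 = gam • ((prox L η (x₀, y₀)).2 - y₀) := by
      change (gam • (prox L η (x₀, y₀)).2 + (1 - gam) • y₀) - y₀ = _
      module
    have h3 := (norm_sub_le (z 1).2 (z 0).2).trans (add_le_add (hR 1) (hR 0))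
    rw [h2, norm_smul, Real.norm_eq_abs, abs_of_pos hgam] at h3
    rw [le_div_iff₀ hθ0, hθ]
    calc ‖y₀ - Y x₀‖ * (gam / (1 + η / α))
        ≤ (1 + η / α) * ‖(prox L η (x₀, y₀)).2 - y₀‖ * (gam / (1 + η / α)) :=
          mul_le_mul_of_nonneg_right h1 (by positivity)
      _ = gam * ‖(prox L η (x₀, y₀)).2 - y₀‖ := by
          have : 1 + η / α ≠ 0 := by positivity
          generalize 1 + η / α = D at *
          field_simp
      _ ≤ 2 * R := by linarith
  have hV0 : V 0 ≤ saddleValue L η (x₀, Y x₀) +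
      η * lam * (2 * K ^ 2 / θ) * (2 * R / θ) ^ 2 := by
    change _ + η * lam * (2 * K ^ 2 / θ) * ‖y₀ - Y x₀‖ ^ 2 ≤ _
    gcongr
    rfl
  have hVN : saddleValue L η ((z N).1, Y (z N).1) ≤ V N :=
    le_add_of_nonneg_right (by positivity)
  linarith [hΔ' (z N).1]

end Rate

theorem theorem3p2 :
    ∃ c : ℝ, 0 < c ∧ c ≤ 1 ∧
      ∀ a b : ℝ, 0 < b → b ≤ 1 → 0 < a → a ≤ c * b →
      ∀ ρ η α : ℝ, 0 < η → ρ < η → 0 < α →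
      ∀ lam gam : ℝ,
        lam = a * (min 1 (|η / ρ - 1| ^ 3) / (1 + η / α) ^ 2) →
        gam = b * min 1 |η / ρ - 1| →
      ∀ Δ R : ℝ, ∃ C : ℝ,
        ∀ (n m : ℕ) (L : Eu n × Eu m → ℝ) (x₀ : Eu n) (y₀ : Eu m),
          IsWeaklyConvexWeaklyConcave ρ L →
          IsInteractionDominantInY η α L →
          (∀ z : Eu n × Eu m, ∃! w : Eu n × Eu m, IsMinimaxPoint (proxObjective L η z) w) ∧
          ((∀ x : Eu n, envelopePrimal L η x₀ ≤ envelopePrimal L η x + (Δ : EReal)) →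
            (∀ k : ℕ, ‖(dampedPPM L η lam gam (x₀, y₀) k).2‖ ≤ R) →
            ∀ ε : ℝ, 0 < ε →
              ∃ T : ℕ, (T : ℝ) ≤ C / ε ^ 2 ∧
                gradNorm L (prox L η (dampedPPM L η lam gam (x₀, y₀) T)) ≤ ε) := by
  -- With K = 2/s the descent condition reduces to 4a + a/2 ≤ 1/4, that is a ≤ 1/18. The time-scale
  -- condition 32a² ≤ b²/4 is weaker than a ≤ b/18.
  refine ⟨1 / 18, by norm_num, by norm_num, ?_⟩
  intro a b hb hb1 ha hab ρ η α hη hρη hα0 lam gam hlam hgam Δ R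
  have hK := le_two_div_min_mul hη hρη
  have hs : 0 < min 1 |η / ρ - 1| := by
    refine lt_min one_pos (abs_pos.2 (sub_ne_zero.2 fun h => ?_))
    rcases eq_or_ne ρ 0 with rfl | hρ
    · simp at h
    · exact hρη.ne' ((div_eq_one_iff_eq hρ).1 h)
  have hs1 := min_le_left 1 |η / ρ - 1|
  rw [min_one_pow_three (abs_nonneg _)] at hlam
  set s := min 1 |η / ρ - 1|
  have hD1 : 1 ≤ 1 + η / α := le_add_of_nonneg_right (by positivity)
  set D := 1 + η / α with hD
  have hD0 : 0 < D := by linarith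
  have hlam0 : 0 < lam := by rw [hlam]; positivity
  have hgam0 : 0 < gam := by rw [hgam]; positivity
  have hgam1 : gam ≤ 1 := by rw [hgam]; exact mul_le_one₀ hb1 hs.le hs1
  have hK1 : 1 ≤ 2 / s := by rw [le_div_iff₀ hs]; linarith
  have hlamK : (2 / s) ^ 2 * D * lam + lam / 2 ≤ 1 / 4 := by
    have e : (2 / s) ^ 2 * D * lam = 4 * a * (s / D) := by rw [hlam]; field_simp; ring
    have h1 : s / D ≤ 1 := by rw [div_le_one hD0]; linarith
    have h2 : s ^ 3 / D ^ 2 ≤ 1 := by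
      rw [div_le_one (by positivity)]
      exact (pow_le_one₀ hs.le hs1).trans (one_le_pow₀ hD1)
    have h3 := mul_le_mul_of_nonneg_left h1 ha.le
    have h4 := mul_le_mul_of_nonneg_left h2 ha.le
    rw [e, hlam]
    linarith
  have hlamgam : 2 * (2 / s) ^ 4 * D ^ 2 * lam ^ 2 ≤ (gam / D) ^ 2 / 4 := by
    have e : 2 * (2 / s) ^ 4 * D ^ 2 * lam ^ 2 = 32 * a ^ 2 * (s / D) ^ 2 := by
      rw [hlam]; field_simp; ring
    have e' : (gam / D) ^ 2 / 4 = b ^ 2 / 4 * (s / D) ^ 2 := by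
      rw [hgam]; ring
    rw [e, e']
    refine mul_le_mul_of_nonneg_right ?_ (sq_nonneg _)
    have := pow_le_pow_left₀ ha.le hab 2
    linarith [sq_nonneg b]
  refine ⟨4 * η / lam * (Δ + η * lam * (2 * (2 / s) ^ 2 / (gam / D)) *
    (2 * R / (gam / D)) ^ 2), fun n m L x₀ y₀ hL hα => ⟨existsUnique_isMinimaxPoint hL hρη,
      fun hΔ hR ε hε => ?_⟩⟩
  have hsum := sum_gradNorm_sq_le hL hα hη hρη hα0 hK1 hK hlam0 hgam0 hgam1 rfl hlamK hlamgam
    hΔ hR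
  -- The empty sum N = 0 shows that the constant is nonnegative, so Δ and R need no sign assumption.
  exact exists_le_div_sq_of_sum_le (by simpa using hsum 0) hsum hε
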